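/- Let $n\ge 1$ be an integer, $Q=2n+2$, $\alpha>Q$, $p_\alpha=\frac{2Q}{Q+\alpha}$ and $p\in(0,p_\alpha)$. Let $\mathbb S^{2n+1}=\{\xi\in\mathbb C^{n+1}:|\xi|=1\}$ with its Euclidean surface measure $d\xi$, write $\xi\cdot\bar\eta=\sum_{j=1}^{n+1}\xi_j\overline{\eta_j}$ and $\|f\|_p=\bigl(\int_{\mathbb S^{2n+1}}|f|^p\,d\xi\bigr)^{1/p}$, and put $$N_{Q,\alpha,p}=\inf\Bigl\{\int_{\mathbb S^{2n+1}}\int_{\mathbb S^{2n+1}} f(\xi)\,g(\eta)\,|1-\xi\cdot\bar\eta|^{(\alpha-Q)/2}\,d\xi\,d\eta \;:\; f,g\in L^p(\mathbb S^{2n+1}),\ f,g\ge 0,\ \|f\|_p=\|g\|_p=1\Bigr\}.$$ Then: (1) There exist nonnegative $f,g\in C^1(\mathbb S^{2n+1})$ with $\|f\|_p=\|g\|_p=1$ and $$N_{Q,\alpha,p}=\int_{\mathbb S^{2n+1}}\int_{\mathbb S^{2n+1}} f(\xi)\,g(\eta)\,|1-\xi\cdot\bar\eta|^{(\alpha-Q)/2}\,d\xi\,d\eta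 .$$ (2) Every pair $(f,g)$ as in (1) satisfies, for all $\xi\in\mathbb S^{2n+1}$, $$N_{Q,\alpha,p}\,f^{p-1}(\xi)=\int_{\mathbb S^{2n+1}}|1-\xi\cdot\bar\eta|^{(\alpha-Q)/2}g(\eta)\,d\eta,\qquad N_{Q,\alpha,p}\,g^{p-1}(\xi)=\int_{\mathbb S^{2n+1}}|1-\xi\cdot\bar\eta|^{(\alpha-Q)/2}f(\eta)\,d\eta .$$ (3) There is a constant $C=C(Q,\alpha,p)>0$ such that every pair $(f,g)$ as in (1) satisfies $\frac1C<f,g<C$ on $\mathbb S^{2n+1}$ and $\|f\|_{C^1(\mathbb S^{2n+1})},\|g\|_{C^1(\mathbb S^{2n+1})}\le C$, where $\|f\|_{C^1(\mathbb S^{2n+1})}=\sup|f|+\sup|\nabla f|$ with $\nabla$ the gradient on the round sphere. -/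

import Mathlib

open MeasureTheory
open scoped ENNReal Manifold ContDiff ComplexConjugate

noncomputable section

/-- The space `ℂ^{n+1}` with its Hermitian (Euclidean) norm. -/
abbrev CSpace (n : ℕ) : Type := EuclideanSpace ℂ (Fin (n + 1))

/-- The unit sphere `S^{2n+1}` of `ℂ^{n+1}`. -/
abbrev CRSphere (n : ℕ) : Type := Metric.sphere (0 : CSpace n) 1

/-- `ℂ^{n+1}` has real dimension `2n+2`; Mathlib's smooth structure on the unit sphere, modelled on
`ℝ^{2n+1}`, is built from this fact. -/
instance fact_finrank_cSpace (n : ℕ) :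
    Fact (Module.finrank ℝ (CSpace n) = 2 * n + 1 + 1) :=
  ⟨by
    rw [← Module.finrank_mul_finrank ℝ ℂ (CSpace n)]
    simp [Complex.finrank_real_complex]
    ring⟩

/-- The homogeneous dimension `Q = 2n + 2`. -/
def homDim (n : ℕ) : ℝ := 2 * (n : ℝ) + 2

/-- The critical exponent `p_α = 2Q / (Q + α)`. -/
def critExp (n : ℕ) (α : ℝ) : ℝ := 2 * homDim n / (homDim n + α)

/-- The Euclidean surface measure `dξ` on `S^{2n+1}`: Lebesgue measure on `ℂ^{n+1}` in polar
coordinates, of total mass `2 π^{n+1} / n!`. -/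
def surfaceMeasure (n : ℕ) : Measure (CRSphere n) :=
  (volume : Measure (CSpace n)).toSphere

/-- The Hermitian product `ξ · η̄ = ∑ j, ξ_j * conj η_j`. -/
def hermProd {n : ℕ} (ξ η : CRSphere n) : ℂ :=
  ∑ j, (ξ : CSpace n) j * conj ((η : CSpace n) j)

/-- The kernel `|1 - ξ · η̄| ^ ((α - Q) / 2)`. -/
def hlsKernel {n : ℕ} (α : ℝ) (ξ η : CRSphere n) : ℝ :=
  ‖1 - hermProd ξ η‖ ^ ((α - homDim n) / 2)

/-- The double integral `∬ f(ξ) g(η) |1 - ξ · η̄| ^ ((α - Q) / 2) dξ dη`, used for nonnegative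
`f` and `g`, with values in `[0, ∞]`. -/
def hlsEnergy {n : ℕ} (α : ℝ) (f g : CRSphere n → ℝ) : ℝ≥0∞ :=
  ∫⁻ ξ, ∫⁻ η, ENNReal.ofReal (f ξ * g η * hlsKernel α ξ η) ∂(surfaceMeasure n)
    ∂(surfaceMeasure n)

/-- `f` is a nonnegative function in `L^p(S^{2n+1})` with `‖f‖_p = (∫ f^p)^{1/p} = 1`. -/
def IsNormalized {n : ℕ} (p : ℝ) (f : CRSphere n → ℝ) : Prop :=
  (∀ ξ, 0 ≤ f ξ) ∧ MemLp f (ENNReal.ofReal p) (surfaceMeasure n) ∧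
    eLpNorm f (ENNReal.ofReal p) (surfaceMeasure n) = 1

/-- The constant `N_{Q,α,p}`: the infimum of the double integral over all nonnegative
`f, g ∈ L^p` with `‖f‖_p = ‖g‖_p = 1`. -/
def hlsConst (n : ℕ) (α p : ℝ) : ℝ≥0∞ :=
  ⨅ (f : CRSphere n → ℝ) (g : CRSphere n → ℝ) (_ : IsNormalized p f) (_ : IsNormalized p g),
    hlsEnergy α f g

/-- `f` belongs to `C^1(S^{2n+1})`. -/
def IsC1 {n : ℕ} (f : CRSphere n → ℝ) : Prop :=
  ContMDiff (𝓡 (2 * n + 1)) 𝓘(ℝ, ℝ) 1 f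

/-- The extension of `f` to `ℂ^{n+1} \ {0}` that is constant along rays, `x ↦ f (x / ‖x‖)`
(with value `0` at the origin). -/
def radialExt {n : ℕ} (f : CRSphere n → ℝ) (x : CSpace n) : ℝ :=
  if hx : x = 0 then 0
  else f ⟨(‖x‖⁻¹ : ℝ) • x, by
    rw [mem_sphere_zero_iff_norm, norm_smul, norm_inv, norm_norm,
      inv_mul_cancel₀ (norm_ne_zero_iff.mpr hx)]⟩

/-- The norm `‖f‖_{C^1} = sup |f| + sup |∇f|` of a `C^1` function on the sphere. The derivative at
`ξ` of the extension of `f` constant along rays vanishes in the normal direction and equals `df_ξ`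
on tangent vectors, so its norm is the length of the gradient of `f` in the round metric. -/
def c1Norm {n : ℕ} (f : CRSphere n → ℝ) : ℝ≥0∞ :=
  (⨆ ξ : CRSphere n, ‖f ξ‖ₑ) + ⨆ ξ : CRSphere n, ‖fderiv ℝ (radialExt f) (ξ : CSpace n)‖ₑ

/-- `(f, g)` is a minimizer pair for `N_{Q,α,p}` consisting of nonnegative `C^1` functions with
`‖f‖_p = ‖g‖_p = 1`. -/
structure IsC1MinimizerPair {n : ℕ} (α p : ℝ) (f g : CRSphere n → ℝ) : Prop where
  left_c1 : IsC1 f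
  right_c1 : IsC1 g
  left_normalized : IsNormalized p f
  right_normalized : IsNormalized p g
  attains : hlsConst n α p = hlsEnergy α f g

end

/-!
Since `p < 1`, for fixed `g` with positive continuous potential `h = K g` the functional
`f ↦ ∫ f h` has a unique normalized minimizer, a multiple of `h ^ (1 / (p - 1))`
(`integral_rpowMinimizer_mul_le`, from the strict concavity of `t ↦ t ^ p`). This has two
consequences. Continuous minimizers satisfy the Euler–Lagrange equations
(`eulerLagrange_of_continuous`), and in minimizing the energy it suffices to consider pairs
`(f, g)` obtained in this way from potentials. Such a pair is as regular as its potentials, so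
compactness amounts to bounds for the potentials from above and, away from zero, from below.

These bounds (`exists_bounds_of_hlsEnergy_le`) are where subcriticality enters. Write `λ` for
`(α - Q) / 2`, so that `K = |1 - ξ · η̄| ^ λ`. The condition `p < 2Q / (Q + α)` means
`λ p / (1 - p) < Q = 2 (n + 1)`, whereas a negative power of `|1 - ξ · η̄|` is integrable when its
exponent is less than `n + 1` in absolute value (`exists_lintegral_rpow_neg_le`). Hence
`K ^ (-t p / (1 - p))` is integrable for some `t` slightly larger than `1 / 2`, and Hölder's
inequality bounds the potential of `f` below by `c (∫ f) ^ (-κ)` with `κ = (1 - t) / t < 1`. The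
energy therefore controls `max (∫ f) (∫ g) ^ (1 - κ)`. So pairs of bounded energy are bounded in
`L¹`, and their potentials are bounded above, bounded below by a positive constant, and
equicontinuous. The theorem of Arzelà–Ascoli then gives continuous minimizers
(`exists_continuous_minimizer`), and the same bounds applied to the Euler–Lagrange equations give
uniform bounds for all of them.

For `λ < 1` the kernel is not differentiable on the diagonal. The potential of a bounded continuous
function is nevertheless `C^1`: the first order expansion of `|w| ^ λ` has a remainder
`O(|v|² (|w| ^ (λ - 2) + 1))` (`Complex.exists_abs_norm_rpow_sub_taylor_le`), which is integrable
over the sphere because `2 - λ < n + 1`. So the potential has a quadratic first order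
remainder, uniformly along the sphere, and this forces its derivative to be Lipschitz there
(`norm_sub_le_of_quadratic_remainder`).
-/

noncomputable section

/-! ### The surface measure of caps -/

instance isFiniteMeasure_surfaceMeasure (n : ℕ) : IsFiniteMeasure (surfaceMeasure n) := by
  unfold surfaceMeasure; infer_instance

instance isOpenPosMeasure_surfaceMeasure (n : ℕ) : (surfaceMeasure n).IsOpenPosMeasure := by
  unfold surfaceMeasure; infer_instance

theorem hermProd_eq_inner {n : ℕ} (ξ η : CRSphere n) :
    hermProd ξ η = inner ℂ (η : CSpace n) (ξ : CSpace n) := by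
  simp [hermProd, PiLp.inner_apply]

theorem CRSphere.norm_coe {n : ℕ} (ξ : CRSphere n) : ‖(ξ : CSpace n)‖ = 1 := by
  simp

theorem norm_hermProd_le_one {n : ℕ} (ξ η : CRSphere n) : ‖hermProd ξ η‖ ≤ 1 := by
  rw [hermProd_eq_inner]
  refine (norm_inner_le_norm _ _).trans ?_
  simp

theorem norm_one_sub_hermProd_comm {n : ℕ} (ξ η : CRSphere n) :
    ‖1 - hermProd ξ η‖ = ‖1 - hermProd η ξ‖ := by
  have h : (1 : ℂ) - hermProd η ξ = conj (1 - hermProd ξ η) := by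
    rw [map_sub, hermProd_eq_inner, hermProd_eq_inner, inner_conj_symm, map_one]
  rw [h, Complex.norm_conj]

theorem continuous_hermProd {n : ℕ} :
    Continuous fun z : CRSphere n × CRSphere n => hermProd z.1 z.2 := by
  simp_rw [hermProd_eq_inner]
  fun_prop

theorem measurePreserving_repr {n : ℕ} (b : OrthonormalBasis (Fin (n + 1)) ℂ (CSpace n)) :
    MeasurePreserving b.repr (volume : Measure (CSpace n)) (volume : Measure (CSpace n)) := by
  let e : CSpace n ≃ₗᵢ[ℝ] CSpace n :=
    { toLinearEquiv := b.repr.toLinearEquiv.restrictScalars ℝ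
      norm_map' := fun x => b.repr.norm_map x }
  exact e.measurePreserving

/-- Lebesgue measure on `ℂ^{n+1}` is, up to a constant, the product of the Lebesgue measures on
the coordinates; the value of the constant plays no role. -/
theorem exists_volume_preimage_ofLp_eq (n : ℕ) :
    ∃ c : ℝ, 0 ≤ c ∧ ∀ s : Set (Fin (n + 1) → ℂ), MeasurableSet s →
      (volume : Measure (CSpace n)) (WithLp.ofLp ⁻¹' s) = ENNReal.ofReal c * volume s := by
  let e : CSpace n ≃L[ℝ] (Fin (n + 1) → ℂ) := PiLp.continuousLinearEquiv 2 ℝ (fun _ => ℂ)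
  have : ((volume : Measure (CSpace n)).map e).IsAddHaarMeasure := e.isAddHaarMeasure_map _
  refine ⟨Measure.addHaarScalarFactor ((volume : Measure (CSpace n)).map e) volume, by simp,
    fun s hs => ?_⟩
  have h := congrArg (fun μ : Measure (Fin (n + 1) → ℂ) => μ s)
    (Measure.isAddLeftInvariant_eq_smul ((volume : Measure (CSpace n)).map e) volume)
  rw [Measure.map_apply e.continuous.measurable hs] at h
  rw [ENNReal.ofReal_coe_nnreal]
  exact h

theorem exists_orthonormalBasis_zero_eq {n : ℕ} (ξ : CRSphere n) :
    ∃ b : OrthonormalBasis (Fin (n + 1)) ℂ (CSpace n), b 0 = ξ := by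
  obtain ⟨b, hb⟩ := Orthonormal.exists_orthonormalBasis_extension_of_card_eq (𝕜 := ℂ)
    (E := CSpace n) (ι := Fin (n + 1)) (by simp) (v := fun _ => (ξ : CSpace n)) (s := {0}) (by
      rw [orthonormal_iff_ite]
      rintro ⟨i, rfl⟩ ⟨j, rfl⟩
      simp [Set.domRestrict_apply])
  exact ⟨b, hb 0 rfl⟩

theorem Complex.volume_re_im_box {a b : ℝ} :
    volume {z : ℂ | z.re ∈ Set.Icc (-a) a ∧ z.im ∈ Set.Icc (-b) b}
      = ENNReal.ofReal (2 * a) * ENNReal.ofReal (2 * b) := by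
  have h := Complex.volume_preserving_equiv_real_prod.measure_preimage
    (s := Set.Icc (-a) a ×ˢ Set.Icc (-b) b)
    (measurableSet_Icc.prod measurableSet_Icc).nullMeasurableSet
  rw [Measure.volume_eq_prod, Measure.prod_prod, Real.volume_Icc, Real.volume_Icc] at h
  rw [show 2 * a = a - -a by ring, show 2 * b = b - -b by ring, ← h]
  rfl

section Caps

open scoped Pointwise

/-- A cap `{η : |1 - ξ · η̄| < ε}` has measure `O(ε^{n+1})`, uniformly in its centre: in an
orthonormal frame starting with `ξ`, the cone over it lies in a box of size `2 × 2ε` in the first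
complex coordinate and of size `√(2ε)` in the `n` others. -/
theorem exists_surfaceMeasure_cap_le (n : ℕ) :
    ∃ C : ℝ, 0 ≤ C ∧ ∀ (ξ : CRSphere n) (ε : ℝ), 0 < ε →
      surfaceMeasure n {η | ‖1 - hermProd ξ η‖ < ε} ≤ ENNReal.ofReal (C * ε ^ (n + 1)) := by
  obtain ⟨c, hc0, hc⟩ := exists_volume_preimage_ofLp_eq n
  refine ⟨(2 * n + 2) * (c * (2 * 2 * (2 * Real.pi) ^ n)), by positivity, fun ξ ε hε => ?_⟩
  obtain ⟨b, hb⟩ := exists_orthonormalBasis_zero_eq ξ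
  set A : Set (CRSphere n) := {η | ‖1 - hermProd ξ η‖ < ε} with hA
  have hAm : MeasurableSet A := by
    have : Continuous fun η : CRSphere n => ‖1 - hermProd ξ η‖ :=
      (continuous_const.sub (continuous_hermProd.comp (continuous_const.prodMk continuous_id))).norm
    exact (isOpen_lt this continuous_const).measurableSet
  let s : Fin (n + 1) → Set ℂ := Fin.cons {z : ℂ | z.re ∈ Set.Icc (-1) 1 ∧ z.im ∈ Set.Icc (-ε) ε}
    (fun _ => Metric.ball (0 : ℂ) (√(2 * ε)))
  have hsm : MeasurableSet (Set.univ.pi s) := by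
    refine MeasurableSet.univ_pi fun i => ?_
    refine Fin.cases ?_ (fun j => ?_) i
    · exact (measurableSet_Icc.preimage Complex.measurable_re).inter
        (measurableSet_Icc.preimage Complex.measurable_im)
    · exact measurableSet_ball
  have hsub : Set.Ioo (0 : ℝ) 1 • ((↑) '' A : Set (CSpace n)) ⊆
      b.repr ⁻¹' (WithLp.ofLp ⁻¹' (Set.univ.pi s)) := by
    rintro _ ⟨r, hr, _, ⟨η, hη, rfl⟩, rfl⟩
    have hη : ‖1 - hermProd ξ η‖ < ε := hη
    have hz : hermProd ξ η = conj (inner ℂ (b 0) (η : CSpace n)) := by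
      rw [hermProd_eq_inner, hb, inner_conj_symm]
    set z : ℂ := inner ℂ (b 0) (η : CSpace n) with hzdef
    have hw : ‖1 - z‖ < ε := by
      rwa [hz, ← map_one (starRingEnd ℂ), ← map_sub, Complex.norm_conj] at hη
    have hz1 : ‖z‖ ≤ 1 := by simpa [hz] using norm_hermProd_le_one ξ η
    have hsum : ∑ i, ‖(inner ℂ (b i) (η : CSpace n) : ℂ)‖ ^ 2 = 1 := by
      rw [b.sum_sq_norm_inner_right]; simp
    have hcoord : ∀ i, (b.repr (r • (η : CSpace n))).ofLp i = r * inner ℂ (b i) (η : CSpace n) := by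
      intro i
      rw [b.repr_apply_apply, ← Complex.coe_smul, inner_smul_right]
    intro i _
    change (b.repr (r • (η : CSpace n))).ofLp i ∈ s i
    rw [hcoord]
    refine Fin.cases ?_ (fun j => ?_) i
    · change ((r : ℂ) * z).re ∈ Set.Icc (-1 : ℝ) 1 ∧ ((r : ℂ) * z).im ∈ Set.Icc (-ε) ε
      rw [Complex.re_ofReal_mul, Complex.im_ofReal_mul, Set.mem_Icc, Set.mem_Icc, ← abs_le,
        ← abs_le, abs_mul, abs_mul, abs_of_pos hr.1]
      have h1 := (Complex.abs_re_le_norm z).trans hz1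
      have h2 : |z.im| ≤ ε := by
        have := Complex.abs_im_le_norm (1 - z)
        simp only [Complex.sub_im, Complex.one_im, zero_sub, abs_neg] at this
        linarith
      constructor
      · nlinarith [hr.1, hr.2, abs_nonneg z.re]
      · nlinarith [hr.1, hr.2, abs_nonneg z.im]
    · change (r : ℂ) * inner ℂ (b j.succ) (η : CSpace n) ∈ Metric.ball (0 : ℂ) (√(2 * ε))
      rw [mem_ball_zero_iff, norm_mul, Complex.norm_real, Real.norm_of_nonneg hr.1.le]
      have h3 : ‖z‖ ^ 2 + ‖(inner ℂ (b j.succ) (η : CSpace n) : ℂ)‖ ^ 2 ≤ 1 := by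
        refine le_of_le_of_eq ?_ hsum
        rw [Fin.sum_univ_succ]
        gcongr
        exact Finset.single_le_sum (f := fun j : Fin n =>
          ‖(inner ℂ (b j.succ) (η : CSpace n) : ℂ)‖ ^ 2) (fun _ _ => by positivity)
          (Finset.mem_univ j)
      have h4 : 1 - ‖z‖ < ε := by
        have := norm_sub_norm_le (1 : ℂ) z
        rw [norm_one] at this
        linarith
      have h5 : ‖(inner ℂ (b j.succ) (η : CSpace n) : ℂ)‖ < √(2 * ε) := by
        apply Real.lt_sqrt_of_sq_lt
        nlinarith [norm_nonneg z]
      nlinarith [hr.1, hr.2, norm_nonneg (inner ℂ (b j.succ) (η : CSpace n) : ℂ)]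
  have hvol : (volume : Measure (CSpace n)) (b.repr ⁻¹' (WithLp.ofLp ⁻¹' (Set.univ.pi s)))
      = ENNReal.ofReal (c * (2 * 2 * (2 * Real.pi) ^ n) * ε ^ (n + 1)) := by
    have hm : MeasurableSet (WithLp.ofLp ⁻¹' (Set.univ.pi s) : Set (CSpace n)) :=
      hsm.preimage (WithLp.measurable_ofLp 2 _)
    rw [(measurePreserving_repr b).measure_preimage hm.nullMeasurableSet, hc _ hsm, volume_pi_pi,
      Fin.prod_univ_succ]
    simp only [s, Fin.cons_zero, Fin.cons_succ, Complex.volume_ball, Finset.prod_const,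
      Finset.card_univ, Fintype.card_fin]
    have hpi : (NNReal.pi : ℝ≥0∞) = ENNReal.ofReal Real.pi := by
      rw [← NNReal.coe_real_pi, ENNReal.ofReal_coe_nnreal]
    rw [Complex.volume_re_im_box, hpi, ← ENNReal.ofReal_pow (by positivity),
      Real.sq_sqrt (by positivity), ← ENNReal.ofReal_mul (by positivity),
      ← ENNReal.ofReal_mul (by positivity), ← ENNReal.ofReal_pow (by positivity),
      ← ENNReal.ofReal_mul (by positivity), ← ENNReal.ofReal_mul (by positivity)]
    congr 1
    rw [mul_pow, mul_pow, mul_pow]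
    ring
  rw [surfaceMeasure, Measure.toSphere_apply' _ hAm, (fact_finrank_cSpace n).out]
  refine (mul_le_mul_right (measure_mono hsub) _).trans ?_
  rw [hvol, ← ENNReal.ofReal_natCast, ← ENNReal.ofReal_mul (by positivity)]
  apply ENNReal.ofReal_le_ofReal
  push_cast
  apply le_of_eq
  ring

end Caps

theorem surfaceMeasure_univ_ne_zero (n : ℕ) : surfaceMeasure n Set.univ ≠ 0 := by
  rw [surfaceMeasure, Measure.measure_univ_ne_zero]
  exact Measure.toSphere_ne_zero _

theorem one_sub_hermProd_eq_zero_iff {n : ℕ} {ξ η : CRSphere n} :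
    1 - hermProd ξ η = 0 ↔ ξ = η := by
  rw [sub_eq_zero, eq_comm, hermProd_eq_inner, inner_eq_one_iff_of_norm_eq_one (by simp) (by simp),
    Subtype.coe_inj, eq_comm]

instance noAtoms_surfaceMeasure (n : ℕ) : NullSingletonClass (surfaceMeasure n) where
  measure_singleton ξ := by
    obtain ⟨C, hC0, hC⟩ := exists_surfaceMeasure_cap_le n
    have h : ∀ ε : ℝ, 0 < ε → surfaceMeasure n {ξ} ≤ ENNReal.ofReal (C * ε ^ (n + 1)) := by
      intro ε hε
      refine (measure_mono ?_).trans (hC ξ ε hε)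
      rintro η rfl
      simpa [one_sub_hermProd_eq_zero_iff.2 rfl] using hε
    have hlim : Filter.Tendsto (fun ε : ℝ => ENNReal.ofReal (C * ε ^ (n + 1)))
        (nhdsWithin 0 (Set.Ioi 0)) (nhds 0) := by
      have h1 : Continuous fun ε : ℝ => ENNReal.ofReal (C * ε ^ (n + 1)) :=
      ENNReal.continuous_ofReal.comp (by fun_prop)
      have := (h1.tendsto 0).mono_left (nhdsWithin_le_nhds (s := Set.Ioi 0))
      simpa using this
    exact le_antisymm (ge_of_tendsto hlim (eventually_nhdsWithin_of_forall h)) zero_le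

/-- Negative powers of `|1 - ξ · η̄|` above the exponent `-(n+1)` are integrable, uniformly
in `ξ`. -/
theorem exists_lintegral_rpow_neg_le (n : ℕ) {β : ℝ} (hβ0 : 0 < β) (hβ : β < n + 1) :
    ∃ B : ℝ, 0 < B ∧ ∀ ξ : CRSphere n,
      ∫⁻ η, ENNReal.ofReal (‖1 - hermProd ξ η‖ ^ (-β)) ∂(surfaceMeasure n) ≤ ENNReal.ofReal B := by
  obtain ⟨C, hC0, hC⟩ := exists_surfaceMeasure_cap_le n
  set γ : ℝ := (n + 1) / β with hγ
  have hγ1 : 1 < γ := by rw [hγ, one_lt_div hβ0]; exact hβ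
  have hint : IntegrableOn (fun t : ℝ => C * t ^ (-γ)) (Set.Ioi 1) :=
    (integrableOn_Ioi_rpow_of_lt (by linarith) one_pos).const_mul C
  refine ⟨(surfaceMeasure n Set.univ).toReal + ∫ t in Set.Ioi (1 : ℝ), C * t ^ (-γ), ?_, ?_⟩
  · have h1 : 0 < (surfaceMeasure n Set.univ).toReal :=
      ENNReal.toReal_pos (surfaceMeasure_univ_ne_zero n) (measure_ne_top _ _)
    have h2 : 0 ≤ ∫ t in Set.Ioi (1 : ℝ), C * t ^ (-γ) :=
      setIntegral_nonneg measurableSet_Ioi fun t ht => by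
        have : (0 : ℝ) < t := one_pos.trans ht
        positivity
    linarith
  intro ξ
  have hcont : Continuous fun η : CRSphere n => ‖1 - hermProd ξ η‖ :=
    (continuous_const.sub (continuous_hermProd.comp (continuous_const.prodMk continuous_id))).norm
  rw [lintegral_eq_lintegral_meas_lt _ (Filter.Eventually.of_forall fun η => by
    simp only [Pi.zero_apply]; positivity) (hcont.measurable.pow_const _).aemeasurable,
    ← Set.Ioc_union_Ioi_eq_Ioi zero_le_one,
    lintegral_union measurableSet_Ioi (Set.Ioc_disjoint_Ioi le_rfl),
    ENNReal.ofReal_add ENNReal.toReal_nonneg (setIntegral_nonneg measurableSet_Ioi fun t ht => by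
        have : (0 : ℝ) < t := one_pos.trans ht
        positivity), ENNReal.ofReal_toReal (measure_ne_top _ _)]
  refine add_le_add ?_ ?_
  · refine (lintegral_mono fun t => measure_mono (Set.subset_univ _)).trans ?_
    simp
  · rw [ofReal_integral_eq_lintegral_ofReal hint ((ae_restrict_iff' measurableSet_Ioi).2
      (Filter.Eventually.of_forall fun t ht => by
        have : (0 : ℝ) < t := one_pos.trans ht
        simp only [Pi.zero_apply]
        positivity))]
    refine setLIntegral_mono' measurableSet_Ioi fun t ht => ?_
    have ht0 : (0 : ℝ) < t := one_pos.trans ht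
    have h1 : {η : CRSphere n | t < ‖1 - hermProd ξ η‖ ^ (-β)} ⊆
        {η | ‖1 - hermProd ξ η‖ < t ^ (-β⁻¹)} := by
      intro η hη
      have hη : t < ‖1 - hermProd ξ η‖ ^ (-β) := hη
      have hpos : 0 < ‖1 - hermProd ξ η‖ := by
        refine (norm_nonneg _).lt_of_ne fun h0 => ?_
        rw [← h0, Real.zero_rpow (by linarith)] at hη
        linarith
      change ‖1 - hermProd ξ η‖ < t ^ (-β⁻¹)
      have h2 := Real.rpow_lt_rpow_of_neg ht0 hη (z := -β⁻¹) (by simpa using hβ0)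
      rwa [← Real.rpow_mul hpos.le, neg_mul_neg, mul_inv_cancel₀ hβ0.ne', Real.rpow_one] at h2
    refine (measure_mono h1).trans ((hC ξ _ (by positivity)).trans (le_of_eq ?_))
    congr 2
    rw [← Real.rpow_natCast, ← Real.rpow_mul ht0.le, hγ]
    congr 1
    push_cast
    field_simp

/-! ### The kernel and the exponents -/

theorem homDim_pos (n : ℕ) : 0 < homDim n := by unfold homDim; positivity

theorem critExp_lt_one {n : ℕ} {α : ℝ} (hα : homDim n < α) : critExp n α < 1 := by
  have := homDim_pos n
  rw [critExp, div_lt_one (by linarith)]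
  linarith

/-- Subcriticality enters only here: the singularity of `K ^ (-t p / (1 - p))` is integrable for
some `t > 1/2`. -/
theorem exists_subcritical_exponent {n : ℕ} {α p : ℝ} (hα : homDim n < α)
    (hp : p < critExp n α) :
    ∃ t : ℝ, 1 / 2 < t ∧ t < 1 ∧ (α - homDim n) / 2 * (t * p / (1 - p)) < n + 1 := by
  have hQ := homDim_pos n
  have hp1 : p < 1 := hp.trans (critExp_lt_one hα)
  have hlt : (α - homDim n) / 2 * (1 / 2 * p / (1 - p)) < n + 1 := by
    rw [critExp, lt_div_iff₀ (by linarith)] at hp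
    have h1 : (n : ℝ) + 1 = homDim n / 2 := by unfold homDim; ring
    rw [h1, ← mul_div_assoc, div_lt_iff₀ (by linarith)]
    nlinarith
  have hcont : Continuous fun t : ℝ => (α - homDim n) / 2 * (t * p / (1 - p)) := by fun_prop
  have hev := (hcont.tendsto (1 / 2)).eventually_lt_const hlt
  obtain ⟨t, ht, ht1, ht2⟩ := ((hev.filter_mono nhdsWithin_le_nhds).and
    (Ioo_mem_nhdsGT (show (1 / 2 : ℝ) < 1 by norm_num))).exists
  exact ⟨t, ht1, ht2, ht⟩

section Kernel

variable {n : ℕ} {α : ℝ}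

theorem hlsKernel_nonneg (ξ η : CRSphere n) : 0 ≤ hlsKernel α ξ η := by
  unfold hlsKernel; positivity

theorem hlsKernel_comm (ξ η : CRSphere n) : hlsKernel α ξ η = hlsKernel α η ξ := by
  unfold hlsKernel; rw [norm_one_sub_hermProd_comm]

theorem norm_one_sub_hermProd_pos {ξ η : CRSphere n} (h : ξ ≠ η) : 0 < ‖1 - hermProd ξ η‖ :=
  norm_pos_iff.2 fun h0 => h (one_sub_hermProd_eq_zero_iff.1 h0)

theorem norm_one_sub_hermProd_le_two (ξ η : CRSphere n) : ‖1 - hermProd ξ η‖ ≤ 2 := by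
  refine (norm_sub_le _ _).trans ?_
  rw [norm_one]
  linarith [norm_hermProd_le_one ξ η]

theorem hlsKernel_pos {ξ η : CRSphere n} (h : ξ ≠ η) : 0 < hlsKernel α ξ η :=
  Real.rpow_pos_of_pos (norm_one_sub_hermProd_pos h) _

theorem hlsKernel_le (hα : homDim n < α) (ξ η : CRSphere n) :
    hlsKernel α ξ η ≤ 2 ^ ((α - homDim n) / 2) :=
  Real.rpow_le_rpow (norm_nonneg _) (norm_one_sub_hermProd_le_two ξ η) (by linarith)

theorem continuous_hlsKernel (hα : homDim n < α) :
    Continuous fun z : CRSphere n × CRSphere n => hlsKernel α z.1 z.2 := by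
  have h : 0 ≤ (α - homDim n) / 2 := by linarith
  unfold hlsKernel
  exact ((continuous_const.sub continuous_hermProd).norm).rpow_const fun _ => Or.inr h

theorem continuous_hlsKernel_right (hα : homDim n < α) (ξ : CRSphere n) :
    Continuous fun η : CRSphere n => hlsKernel α ξ η :=
  Continuous.comp (g := fun z : CRSphere n × CRSphere n => hlsKernel α z.1 z.2)
    (f := fun η => (ξ, η)) (continuous_hlsKernel hα) (Continuous.prodMk_right ξ)

end Kernel

/-! ### A priori bounds for pairs of bounded energy -/

/-- The potential `ξ ↦ ∫ |1 - ξ · η̄| ^ ((α - Q) / 2) F(η) dη` of a function with values in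
`[0, ⊤]`. -/
def lintegralPotential {n : ℕ} (α : ℝ) (F : CRSphere n → ℝ≥0∞) (ξ : CRSphere n) : ℝ≥0∞ :=
  ∫⁻ η, ENNReal.ofReal (hlsKernel α ξ η) * F η ∂(surfaceMeasure n)

section APriori

variable {n : ℕ} {α p : ℝ}

theorem hlsEnergy_eq_lintegral_mul {f : CRSphere n → ℝ} (hf : ∀ ξ, 0 ≤ f ξ) (g : CRSphere n → ℝ) :
    hlsEnergy α f g = ∫⁻ ξ, ENNReal.ofReal (f ξ) *
      lintegralPotential α (fun η => ENNReal.ofReal (g η)) ξ ∂(surfaceMeasure n) := by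
  unfold hlsEnergy lintegralPotential
  refine lintegral_congr fun ξ => ?_
  rw [← lintegral_const_mul' _ _ ENNReal.ofReal_ne_top]
  refine lintegral_congr fun η => ?_
  rw [mul_assoc, ENNReal.ofReal_mul (hf ξ), mul_comm (g η),
    ENNReal.ofReal_mul (hlsKernel_nonneg _ _)]

theorem hlsEnergy_comm (hα : homDim n < α) {f g : CRSphere n → ℝ}
    (hf : AEMeasurable f (surfaceMeasure n)) (hg : AEMeasurable g (surfaceMeasure n)) :
    hlsEnergy α f g = hlsEnergy α g f := by
  unfold hlsEnergy
  rw [lintegral_lintegral_swap]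
  · refine lintegral_congr fun η => lintegral_congr fun ξ => ?_
    rw [hlsKernel_comm, mul_comm (f ξ)]
  · refine AEMeasurable.ennreal_ofReal ?_
    exact (hf.comp_fst.mul hg.comp_snd).mul (continuous_hlsKernel hα).measurable.aemeasurable

theorem IsNormalized.aemeasurable {f : CRSphere n → ℝ} (hf : IsNormalized p f) :
    AEMeasurable f (surfaceMeasure n) := hf.2.1.1.aemeasurable

theorem eLpNorm_ofReal_eq {f : CRSphere n → ℝ} (hp0 : 0 < p) (hf : ∀ ξ, 0 ≤ f ξ) :
    eLpNorm f (ENNReal.ofReal p) (surfaceMeasure n)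
      = (∫⁻ ξ, ENNReal.ofReal (f ξ) ^ p ∂(surfaceMeasure n)) ^ (1 / p) := by
  rw [eLpNorm_eq_lintegral_rpow_enorm_toReal (by simpa using hp0) ENNReal.ofReal_ne_top,
    ENNReal.toReal_ofReal hp0.le]
  simp_rw [Real.enorm_of_nonneg (hf _)]

theorem IsNormalized.lintegral_rpow_eq_one {f : CRSphere n → ℝ} (hp0 : 0 < p)
    (hf : IsNormalized p f) : ∫⁻ ξ, ENNReal.ofReal (f ξ) ^ p ∂(surfaceMeasure n) = 1 := by
  have h := hf.2.2
  rw [eLpNorm_ofReal_eq hp0 hf.1] at h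
  have h2 := congrArg (fun x : ℝ≥0∞ => x ^ p) h
  simpa [← ENNReal.rpow_mul, hp0.ne'] using h2

theorem lintegral_ne_zero_of_lintegral_rpow_eq_one {F : CRSphere n → ℝ≥0∞} (hp0 : 0 < p)
    (hF : AEMeasurable F (surfaceMeasure n)) (h1 : ∫⁻ ξ, F ξ ^ p ∂(surfaceMeasure n) = 1) :
    ∫⁻ ξ, F ξ ∂(surfaceMeasure n) ≠ 0 := by
  intro h0
  rw [lintegral_eq_zero_iff' hF] at h0
  have : ∫⁻ ξ, F ξ ^ p ∂(surfaceMeasure n) = 0 := by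
    rw [lintegral_eq_zero_iff' (hF.pow_const p)]
    filter_upwards [h0] with ξ hξ
    rw [hξ]
    simpa using hp0
  simp [this] at h1

/-- Two applications of Hölder's inequality: `∫ F^p ≤ (∫ F K^t)^p (∫ K^{-tp/(1-p)})^{1-p}` and
`∫ F K^t ≤ (∫ F)^{1-t} (∫ F K)^t`. The last factor of the first is finite for `t` as in
`exists_subcritical_exponent`. -/
theorem exists_le_lintegral_rpow_mul_lintegralPotential_rpow (hα : homDim n < α) (hp0 : 0 < p)
    (hp1 : p < 1) {t : ℝ} (ht0 : 0 < t) (ht1 : t < 1)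
    (ht : (α - homDim n) / 2 * (t * p / (1 - p)) < n + 1) :
    ∃ c : ℝ, 0 < c ∧ ∀ F : CRSphere n → ℝ≥0∞, AEMeasurable F (surfaceMeasure n) →
      ∫⁻ ξ, F ξ ^ p ∂(surfaceMeasure n) = 1 → ∀ ξ : CRSphere n,
        ENNReal.ofReal c ≤
          (∫⁻ η, F η ∂(surfaceMeasure n)) ^ (1 - t) * lintegralPotential α F ξ ^ t := by
  obtain ⟨B, hB0, hB⟩ := exists_lintegral_rpow_neg_le n
    (β := (α - homDim n) / 2 * (t * p / (1 - p)))
    (mul_pos (by linarith) (div_pos (mul_pos ht0 hp0) (by linarith))) ht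
  refine ⟨(B ^ (1 - p))⁻¹ ^ (1 / p), by positivity, fun F hF h1 ξ => ?_⟩
  set σ := surfaceMeasure n
  let k : CRSphere n → ℝ≥0∞ := fun η => ENNReal.ofReal (hlsKernel α ξ η)
  have hk : Measurable k :=
    ENNReal.measurable_ofReal.comp (continuous_hlsKernel_right hα ξ).measurable
  have hne : ∀ᵐ η ∂σ, ξ ≠ η := by
    have : ∀ᵐ η ∂σ, η ∉ ({ξ} : Set (CRSphere n)) :=
      measure_eq_zero_iff_ae_notMem.1 (measure_singleton _)
    filter_upwards [this] with η hη h
    exact hη h.symm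
  have hk0 : ∀ η, ξ ≠ η → k η ≠ 0 := fun η h => by
    simpa [k] using hlsKernel_pos h
  have hkt : ∀ η, k η ≠ ⊤ := fun η => ENNReal.ofReal_ne_top
  have hp1' : 0 < 1 - p := by linarith
  have step1 : (1 : ℝ≥0∞) ≤ (∫⁻ η, F η * k η ^ t ∂σ) ^ p * ENNReal.ofReal B ^ (1 - p) := by
    calc (1 : ℝ≥0∞) = ∫⁻ η, (F η * k η ^ t) ^ p * (k η ^ (-(t * p / (1 - p)))) ^ (1 - p) ∂σ := by
          rw [← h1]
          refine lintegral_congr_ae ?_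
          filter_upwards [hne] with η hη
          rw [ENNReal.mul_rpow_of_nonneg _ _ hp0.le, ← ENNReal.rpow_mul, ← ENNReal.rpow_mul,
            mul_assoc, ← ENNReal.rpow_add _ _ (hk0 η hη) (hkt η)]
          have : t * p + -(t * p / (1 - p)) * (1 - p) = 0 := by field_simp; ring
          rw [this, ENNReal.rpow_zero, mul_one]
      _ ≤ (∫⁻ η, F η * k η ^ t ∂σ) ^ p * (∫⁻ η, k η ^ (-(t * p / (1 - p))) ∂σ) ^ (1 - p) :=
          ENNReal.lintegral_mul_norm_pow_le (hF.mul (hk.pow_const t).aemeasurable)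
            (hk.pow_const _).aemeasurable hp0.le hp1'.le (by ring)
      _ ≤ _ := by
          gcongr
          refine le_trans (le_of_eq ?_) (hB ξ)
          refine lintegral_congr_ae ?_
          filter_upwards [hne] with η hη
          simp only [k]
          rw [ENNReal.ofReal_rpow_of_pos (hlsKernel_pos hη), hlsKernel,
            ← Real.rpow_mul (norm_nonneg _), mul_neg]
  have step2 : ∫⁻ η, F η * k η ^ t ∂σ ≤
      (∫⁻ η, F η ∂σ) ^ (1 - t) * lintegralPotential α F ξ ^ t := by
    calc ∫⁻ η, F η * k η ^ t ∂σ = ∫⁻ η, F η ^ (1 - t) * (k η * F η) ^ t ∂σ := by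
          refine lintegral_congr fun η => ?_
          rw [ENNReal.mul_rpow_of_nonneg _ _ ht0.le, mul_comm (k η ^ t), ← mul_assoc,
            ← ENNReal.rpow_add_of_nonneg _ _ (by linarith) ht0.le]
          simp
      _ ≤ _ := ENNReal.lintegral_mul_norm_pow_le hF (hk.aemeasurable.mul hF) (by linarith) ht0.le
            (by ring)
  set X := (∫⁻ η, F η ∂σ) ^ (1 - t) * lintegralPotential α F ξ ^ t
  have step3 : (1 : ℝ≥0∞) ≤ X ^ p * ENNReal.ofReal (B ^ (1 - p)) := by
    rw [← ENNReal.ofReal_rpow_of_pos hB0]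
    exact step1.trans (by gcongr)
  have step4 : ENNReal.ofReal ((B ^ (1 - p))⁻¹) ≤ X ^ p := by
    rw [ENNReal.ofReal_inv_of_pos (by positivity), ← one_div]
    exact ENNReal.div_le_of_le_mul step3
  calc ENNReal.ofReal ((B ^ (1 - p))⁻¹ ^ (1 / p))
      = ENNReal.ofReal ((B ^ (1 - p))⁻¹) ^ (1 / p) :=
        (ENNReal.ofReal_rpow_of_pos (by positivity)).symm
    _ ≤ (X ^ p) ^ (1 / p) := by gcongr
    _ = X := by rw [← ENNReal.rpow_mul, mul_one_div_cancel hp0.ne', ENNReal.rpow_one]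

theorem ofReal_rpow_le_of_le_mul_rpow {c a t : ℝ} {X H : ℝ≥0∞} (hc : 0 < c) (ha : 0 < a)
    (ht0 : 0 < t) (ht1 : t < 1) (hX : X ≤ ENNReal.ofReal a)
    (h : ENNReal.ofReal c ≤ X ^ (1 - t) * H ^ t) :
    ENNReal.ofReal ((c / a ^ (1 - t)) ^ (1 / t)) ≤ H := by
  have h1 : ENNReal.ofReal c ≤ H ^ t * ENNReal.ofReal (a ^ (1 - t)) := by
    rw [← ENNReal.ofReal_rpow_of_pos ha, mul_comm]
    refine h.trans ?_
    gcongr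
  have h2 : ENNReal.ofReal (c / a ^ (1 - t)) ≤ H ^ t := by
    rw [ENNReal.ofReal_div_of_pos (by positivity)]
    exact ENNReal.div_le_of_le_mul h1
  calc ENNReal.ofReal ((c / a ^ (1 - t)) ^ (1 / t))
      = ENNReal.ofReal (c / a ^ (1 - t)) ^ (1 / t) :=
        (ENNReal.ofReal_rpow_of_pos (by positivity)).symm
    _ ≤ (H ^ t) ^ (1 / t) := by gcongr
    _ = H := by rw [← ENNReal.rpow_mul, mul_one_div_cancel ht0.ne', ENNReal.rpow_one]

/-- If the energy is finite then `f` is integrable: the potential of `f` is finite at two distinct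
points, and the kernels at these two points do not vanish simultaneously. -/
theorem lintegral_ne_top_of_hlsEnergy_ne_top (hα : homDim n < α) (hp0 : 0 < p)
    {f g : CRSphere n → ℝ} (hf : IsNormalized p f) (hg : IsNormalized p g)
    (hE : hlsEnergy α g f ≠ ⊤) : ∫⁻ ξ, ENNReal.ofReal (f ξ) ∂(surfaceMeasure n) ≠ ⊤ := by
  set σ := surfaceMeasure n
  set F : CRSphere n → ℝ≥0∞ := fun ξ => ENNReal.ofReal (f ξ)
  have hFm : AEMeasurable F σ := hf.aemeasurable.ennreal_ofReal
  rw [hlsEnergy_eq_lintegral_mul hg.1] at hE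
  have hker : Measurable fun z : CRSphere n × CRSphere n => ENNReal.ofReal (hlsKernel α z.1 z.2) :=
    ENNReal.measurable_ofReal.comp (continuous_hlsKernel hα).measurable
  have hpot : AEMeasurable (lintegralPotential α F) σ :=
    AEMeasurable.lintegral_prod_right' (f := fun z : CRSphere n × CRSphere n =>
      ENNReal.ofReal (hlsKernel α z.1 z.2) * F z.2) (hker.aemeasurable.mul hFm.comp_snd)
  have hfin := ae_lt_top' (hg.aemeasurable.ennreal_ofReal.mul hpot) hE
  set P : Set (CRSphere n) := {ξ | lintegralPotential α F ξ ≠ ⊤}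
  have hP : σ P ≠ 0 := by
    intro hP0
    refine lintegral_ne_zero_of_lintegral_rpow_eq_one hp0 hg.aemeasurable.ennreal_ofReal
      (hg.lintegral_rpow_eq_one hp0) ?_
    rw [lintegral_eq_zero_iff' hg.aemeasurable.ennreal_ofReal]
    filter_upwards [hfin, measure_eq_zero_iff_ae_notMem.1 hP0] with ξ h1 h2
    simp only [P, Set.mem_ofPred_eq, not_not] at h2
    by_contra h3
    simp only [Pi.mul_apply, h2] at h1
    rw [ENNReal.mul_top h3] at h1
    exact lt_irrefl _ h1
  obtain ⟨ξ₁, h₁⟩ := nonempty_of_measure_ne_zero hP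
  obtain ⟨ξ₂, h₂, h₁₂⟩ : ∃ ξ₂ ∈ P, ξ₂ ≠ ξ₁ := by
    by_contra! hcon
    exact hP (measure_mono_null (fun ξ hξ => hcon ξ hξ) (measure_singleton ξ₁))
  have hcont : Continuous fun η : CRSphere n => hlsKernel α ξ₁ η + hlsKernel α ξ₂ η :=
    (continuous_hlsKernel_right hα ξ₁).add (continuous_hlsKernel_right hα ξ₂)
  obtain ⟨η₀, -, hη₀⟩ := isCompact_univ.exists_isMinOn ⟨ξ₁, Set.mem_univ _⟩ hcont.continuousOn
  set m := hlsKernel α ξ₁ η₀ + hlsKernel α ξ₂ η₀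
  have hm : 0 < m := by
    by_cases h : ξ₁ = η₀
    · exact add_pos_of_nonneg_of_pos (hlsKernel_nonneg _ _) (hlsKernel_pos (h ▸ h₁₂))
    · exact add_pos_of_pos_of_nonneg (hlsKernel_pos h) (hlsKernel_nonneg _ _)
  have hle : ENNReal.ofReal m * ∫⁻ η, F η ∂σ
      ≤ lintegralPotential α F ξ₁ + lintegralPotential α F ξ₂ := by
    unfold lintegralPotential
    rw [← lintegral_const_mul' _ _ ENNReal.ofReal_ne_top, ← lintegral_add_left']
    · refine lintegral_mono fun η => ?_
      rw [← add_mul, ← ENNReal.ofReal_add (hlsKernel_nonneg _ _) (hlsKernel_nonneg _ _)]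
      gcongr
      exact hη₀ (Set.mem_univ η)
    · exact (hker.comp (measurable_const.prodMk measurable_id)).aemeasurable.mul hFm
  intro htop
  rw [htop, ENNReal.mul_top (by simpa using hm)] at hle
  exact (ENNReal.add_lt_top.2 ⟨lt_top_iff_ne_top.2 h₁, lt_top_iff_ne_top.2 h₂⟩).not_ge hle

/-- A pair of normalized functions of bounded energy is bounded in `L¹`, and the potentials of
both functions are bounded below by a positive constant. With `κ = (1 - t) / t < 1` Hölder's
inequality bounds the potential of `f` below by `c (∫ f)^{-κ}`, hence the energy below by
`c (∫ f)^{-κ} ∫ g` and, by symmetry, by `c (∫ g)^{-κ} ∫ f`; so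
`max (∫ f) (∫ g) ^ (1 - κ)` is controlled by the energy. -/
theorem exists_bounds_of_hlsEnergy_le (hα : homDim n < α) (hp0 : 0 < p) (hp : p < critExp n α)
    (C : ℝ) :
    ∃ M c : ℝ, 0 < M ∧ 0 < c ∧ ∀ f g : CRSphere n → ℝ, IsNormalized p f → IsNormalized p g →
      hlsEnergy α f g ≤ ENNReal.ofReal C →
      (∫⁻ ξ, ENNReal.ofReal (f ξ) ∂(surfaceMeasure n) ≤ ENNReal.ofReal M) ∧
      (∫⁻ ξ, ENNReal.ofReal (g ξ) ∂(surfaceMeasure n) ≤ ENNReal.ofReal M) ∧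
      (∀ ξ, ENNReal.ofReal c ≤ lintegralPotential α (fun η => ENNReal.ofReal (f η)) ξ) ∧
      (∀ ξ, ENNReal.ofReal c ≤ lintegralPotential α (fun η => ENNReal.ofReal (g η)) ξ) := by
  obtain ⟨t, ht2, ht1, ht⟩ := exists_subcritical_exponent hα hp
  have ht0 : 0 < t := by linarith
  obtain ⟨c, hc0, hc⟩ := exists_le_lintegral_rpow_mul_lintegralPotential_rpow hα hp0
    (hp.trans (critExp_lt_one hα)) ht0 ht1 ht
  set κ := (1 - t) / t with hκ
  have hκ1 : 0 < 1 - κ := by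
    rw [hκ, sub_pos, div_lt_one ht0]; linarith
  have hcpow : ∀ a : ℝ, 0 < a → (c / a ^ (1 - t)) ^ (1 / t) = c ^ (1 / t) * a ^ (-κ) := by
    intro a ha
    rw [Real.div_rpow hc0.le (by positivity), ← Real.rpow_mul ha.le, Real.rpow_neg ha.le,
      div_eq_mul_inv, hκ, mul_one_div]
  set D := max C 1
  have hD : 0 < D := by positivity
  set M := (D / c ^ (1 / t)) ^ (1 / (1 - κ)) with hM
  have hM0 : 0 < M := by positivity
  -- the larger of the two masses is at most `M`
  have key : ∀ f g : CRSphere n → ℝ, IsNormalized p f → IsNormalized p g →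
      hlsEnergy α f g ≤ ENNReal.ofReal C →
      ∫⁻ ξ, ENNReal.ofReal (g ξ) ∂(surfaceMeasure n) ≤
        ∫⁻ ξ, ENNReal.ofReal (f ξ) ∂(surfaceMeasure n) →
      ∫⁻ ξ, ENNReal.ofReal (f ξ) ∂(surfaceMeasure n) ≤ ENNReal.ofReal M := by
    intro f g hf hg hE hgf
    have hE' : hlsEnergy α g f ≠ ⊤ := by
      rw [hlsEnergy_comm hα hg.aemeasurable hf.aemeasurable]
      exact (hE.trans_lt ENNReal.ofReal_lt_top).ne
    have hftop := lintegral_ne_top_of_hlsEnergy_ne_top hα hp0 hf hg hE'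
    have hf0 := lintegral_ne_zero_of_lintegral_rpow_eq_one hp0 hf.aemeasurable.ennreal_ofReal
      (hf.lintegral_rpow_eq_one hp0)
    set a := (∫⁻ ξ, ENNReal.ofReal (f ξ) ∂(surfaceMeasure n)).toReal with ha
    have ha0 : 0 < a := ENNReal.toReal_pos hf0 hftop
    have hfa : ∫⁻ ξ, ENNReal.ofReal (f ξ) ∂(surfaceMeasure n) = ENNReal.ofReal a :=
      (ENNReal.ofReal_toReal hftop).symm
    have hlow : ∀ ξ, ENNReal.ofReal (c ^ (1 / t) * a ^ (-κ)) ≤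
        lintegralPotential α (fun η => ENNReal.ofReal (g η)) ξ := by
      intro ξ
      rw [← hcpow a ha0]
      exact ofReal_rpow_le_of_le_mul_rpow hc0 ha0 ht0 ht1 (hgf.trans hfa.le)
        (hc _ hg.aemeasurable.ennreal_ofReal (hg.lintegral_rpow_eq_one hp0) ξ)
    have hmain : ENNReal.ofReal (a * (c ^ (1 / t) * a ^ (-κ))) ≤ ENNReal.ofReal D := by
      refine le_trans ?_ (hE.trans (ENNReal.ofReal_le_ofReal (le_max_left _ _)))
      rw [hlsEnergy_eq_lintegral_mul hf.1, ENNReal.ofReal_mul ha0.le, ← hfa,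
        ← lintegral_mul_const' _ _ ENNReal.ofReal_ne_top]
      exact lintegral_mono fun ξ => by gcongr; exact hlow ξ
    rw [ENNReal.ofReal_le_ofReal_iff hD.le] at hmain
    have h1 : a ^ (1 - κ) ≤ D / c ^ (1 / t) := by
      rw [le_div_iff₀ (by positivity), sub_eq_add_neg, Real.rpow_add ha0, Real.rpow_one]
      linarith
    rw [hfa]
    refine ENNReal.ofReal_le_ofReal ?_
    calc a = (a ^ (1 - κ)) ^ (1 / (1 - κ)) := by
          rw [← Real.rpow_mul ha0.le, mul_one_div_cancel hκ1.ne', Real.rpow_one]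
      _ ≤ M := Real.rpow_le_rpow (by positivity) h1 (by positivity)
  refine ⟨M, (c / M ^ (1 - t)) ^ (1 / t), hM0, by positivity, fun f g hf hg hE => ?_⟩
  have hE' : hlsEnergy α g f ≤ ENNReal.ofReal C := by
    rwa [hlsEnergy_comm hα hg.aemeasurable hf.aemeasurable]
  have hfg : ∫⁻ ξ, ENNReal.ofReal (f ξ) ∂(surfaceMeasure n) ≤ ENNReal.ofReal M ∧
      ∫⁻ ξ, ENNReal.ofReal (g ξ) ∂(surfaceMeasure n) ≤ ENNReal.ofReal M := by
    rcases le_total (∫⁻ ξ, ENNReal.ofReal (g ξ) ∂(surfaceMeasure n))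
      (∫⁻ ξ, ENNReal.ofReal (f ξ) ∂(surfaceMeasure n)) with h | h
    · have := key f g hf hg hE h
      exact ⟨this, h.trans this⟩
    · have := key g f hg hf hE' h
      exact ⟨h.trans this, this⟩
  exact ⟨hfg.1, hfg.2,
    fun ξ => ofReal_rpow_le_of_le_mul_rpow hc0 hM0 ht0 ht1 hfg.1
      (hc _ hf.aemeasurable.ennreal_ofReal (hf.lintegral_rpow_eq_one hp0) ξ),
    fun ξ => ofReal_rpow_le_of_le_mul_rpow hc0 hM0 ht0 ht1 hfg.2
      (hc _ hg.aemeasurable.ennreal_ofReal (hg.lintegral_rpow_eq_one hp0) ξ)⟩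

end APriori

/-! ### The normalized minimizer of a linear functional in `L^p`, `p < 1` -/

theorem Real.rpow_le_tangent {p s t : ℝ} (hp0 : 0 < p) (hp1 : p < 1) (hs : 0 < s) (ht : 0 ≤ t) :
    t ^ p ≤ s ^ p + p * s ^ (p - 1) * (t - s) ∧
      (t ^ p = s ^ p + p * s ^ (p - 1) * (t - s) → t = s) := by
  have hx : -1 ≤ t / s - 1 := by have : 0 ≤ t / s := by positivity
                                 linarith
  have e1 : t ^ p = s ^ p * (1 + (t / s - 1)) ^ p := by
    rw [add_sub_cancel, ← Real.mul_rpow hs.le (by positivity), mul_div_cancel₀ _ hs.ne']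
  have e2 : s ^ p + p * s ^ (p - 1) * (t - s) = s ^ p * (1 + p * (t / s - 1)) := by
    rw [Real.rpow_sub_one hs.ne']; field_simp
  have hsp : 0 < s ^ p := by positivity
  rw [e1, e2]
  refine ⟨mul_le_mul_of_nonneg_left
    (rpow_one_add_le_one_add_mul_self hx hp0.le hp1.le) hsp.le, fun h => ?_⟩
  by_contra hne
  refine (rpow_one_add_lt_one_add_mul_self hx (fun h0 => hne ?_) hp0 hp1).ne
    (mul_left_cancel₀ hsp.ne' h)
  rwa [sub_eq_zero, div_eq_one_iff_eq hs.ne'] at h0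

/-- For `0 < p < 1` and `h > 0`, the function minimizing `∫ f h` among `f ≥ 0` with
`∫ f ^ p = 1`; it is the multiple of `h ^ (1 / (p - 1))` with that normalization. -/
def rpowMinimizer {X : Type*} [MeasurableSpace X] (μ : Measure X) (p : ℝ) (h : X → ℝ) (x : X) :
    ℝ :=
  (∫ y, h y ^ (p / (p - 1)) ∂μ) ^ (-(1 / p)) * h x ^ (1 / (p - 1))

theorem Continuous.rpow_const_of_pos {X : Type*} [TopologicalSpace X] {h : X → ℝ}
    (hh : Continuous h) (hpos : ∀ x, 0 < h x) (r : ℝ) : Continuous fun x => h x ^ r :=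
  hh.rpow_const fun x => Or.inl (hpos x).ne'

theorem continuous_rpowMinimizer {X : Type*} [TopologicalSpace X] [MeasurableSpace X]
    {μ : Measure X} {p : ℝ} {h : X → ℝ} (hh : Continuous h) (hpos : ∀ x, 0 < h x) :
    Continuous (rpowMinimizer μ p h) :=
  continuous_const.mul (hh.rpow_const_of_pos hpos _)

section Minimizer

variable {X : Type*} [TopologicalSpace X] [CompactSpace X] [MeasurableSpace X] [BorelSpace X]
  {μ : Measure X} [IsFiniteMeasure μ] {p : ℝ} {h : X → ℝ}

theorem Continuous.integrable_of_compactSpace {f : X → ℝ} (hf : Continuous f) :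
    Integrable f μ :=
  hf.integrable_of_hasCompactSupport (HasCompactSupport.of_compactSpace f)

theorem integral_rpow_pos (hμ : μ Set.univ ≠ 0) (hh : Continuous h) (hpos : ∀ x, 0 < h x) (r : ℝ) :
    0 < ∫ x, h x ^ r ∂μ := by
  have hr : ∀ x, 0 < h x ^ r := fun x => Real.rpow_pos_of_pos (hpos x) r
  rw [integral_pos_iff_support_of_nonneg (fun x => (hr x).le)
    (hh.rpow_const_of_pos hpos r).integrable_of_compactSpace]
  have : Function.support (fun x => h x ^ r) = Set.univ :=
    Set.eq_univ_of_forall fun x => (hr x).ne'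
  rw [this]
  exact pos_iff_ne_zero.2 hμ

theorem rpowMinimizer_pos (hμ : μ Set.univ ≠ 0) (hh : Continuous h) (hpos : ∀ x, 0 < h x) (x : X) :
    0 < rpowMinimizer μ p h x :=
  mul_pos (Real.rpow_pos_of_pos (integral_rpow_pos hμ hh hpos _) _)
    (Real.rpow_pos_of_pos (hpos x) _)

theorem integral_rpowMinimizer_rpow (hμ : μ Set.univ ≠ 0) (hp0 : 0 < p)
    (hh : Continuous h) (hpos : ∀ x, 0 < h x) :
    ∫ x, rpowMinimizer μ p h x ^ p ∂μ = 1 := by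
  have hA := integral_rpow_pos hμ hh hpos (p / (p - 1))
  have : ∀ x, rpowMinimizer μ p h x ^ p =
      (∫ y, h y ^ (p / (p - 1)) ∂μ)⁻¹ * h x ^ (p / (p - 1)) := fun x => by
    have h1 : -(1 / p) * p = -1 := by field_simp
    have h2 : 1 / (p - 1) * p = p / (p - 1) := by ring
    rw [rpowMinimizer, Real.mul_rpow (by positivity) (Real.rpow_nonneg (hpos x).le _),
      ← Real.rpow_mul hA.le, ← Real.rpow_mul (hpos x).le, h1, h2, Real.rpow_neg_one]
  simp_rw [this]
  rw [integral_const_mul, inv_mul_cancel₀ hA.ne']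

theorem rpowMinimizer_rpow_sub_one (hμ : μ Set.univ ≠ 0) (hp1 : p < 1)
    (hh : Continuous h) (hpos : ∀ x, 0 < h x) :
    ∃ k : ℝ, 0 < k ∧ ∀ x, rpowMinimizer μ p h x ^ (p - 1) = k * h x := by
  have hA := integral_rpow_pos hμ hh hpos (p / (p - 1))
  refine ⟨((∫ y, h y ^ (p / (p - 1)) ∂μ) ^ (-(1 / p))) ^ (p - 1), by positivity, fun x => ?_⟩
  have h2 : 1 / (p - 1) * (p - 1) = 1 := one_div_mul_cancel (by linarith)
  rw [rpowMinimizer, Real.mul_rpow (by positivity) (Real.rpow_nonneg (hpos x).le _),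
    ← Real.rpow_mul (hpos x).le, h2, Real.rpow_one]

/-- Integrating the tangent line inequality `f^p ≤ s^p + p s^(p-1) (f - s)` at
`s = rpowMinimizer μ p h`, where `s^(p-1)` is a multiple of `h`, gives the minimality. Since the
inequality is strict for `f ≠ s`, it also gives the uniqueness of the minimizer. -/
theorem integral_rpowMinimizer_mul_le (hμ : μ Set.univ ≠ 0) (hp0 : 0 < p) (hp1 : p < 1)
    (hh : Continuous h) (hpos : ∀ x, 0 < h x) {f : X → ℝ} (hf0 : ∀ x, 0 ≤ f x)
    (hf : Integrable f μ) (hfp : Integrable (fun x => f x ^ p) μ) (hf1 : ∫ x, f x ^ p ∂μ = 1) :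
    ∫ x, rpowMinimizer μ p h x * h x ∂μ ≤ ∫ x, f x * h x ∂μ ∧
      (∫ x, f x * h x ∂μ ≤ ∫ x, rpowMinimizer μ p h x * h x ∂μ →
        f =ᵐ[μ] rpowMinimizer μ p h) := by
  obtain ⟨k, hk0, hk⟩ := rpowMinimizer_rpow_sub_one hμ hp1 hh hpos
  set s := rpowMinimizer μ p h with hs
  have hspos : ∀ x, 0 < s x := rpowMinimizer_pos hμ hh hpos
  have hsc : Continuous s := continuous_rpowMinimizer hh hpos
  have hs1 : ∫ x, s x ^ p ∂μ = 1 := integral_rpowMinimizer_rpow hμ hp0 hh hpos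
  have hspi : Integrable (fun x => s x ^ p) μ :=
    (hsc.rpow_const_of_pos hspos p).integrable_of_compactSpace
  have hshi : Integrable (fun x => s x * h x) μ := (hsc.mul hh).integrable_of_compactSpace
  obtain ⟨D, hD⟩ := isCompact_univ.exists_bound_of_continuousOn hh.continuousOn
  have hfhi : Integrable (fun x => f x * h x) μ :=
    hf.mul_bdd (c := D) hh.aestronglyMeasurable (Filter.Eventually.of_forall fun x => hD x trivial)
  have htan := fun x => Real.rpow_le_tangent hp0 hp1 (hspos x) (hf0 x)
  have hrw : ∀ x, s x ^ p + p * s x ^ (p - 1) * (f x - s x)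
      = s x ^ p + p * k * (f x * h x - s x * h x) := fun x => by rw [hk]; ring
  simp_rw [hrw] at htan
  have hdi : Integrable (fun x => p * k * (f x * h x - s x * h x)) μ :=
    (hfhi.sub hshi).const_mul _
  have hRi : Integrable (fun x => s x ^ p + p * k * (f x * h x - s x * h x)) μ :=
    hspi.add hdi
  have hRint : ∫ x, (s x ^ p + p * k * (f x * h x - s x * h x)) ∂μ
      = 1 + p * k * (∫ x, f x * h x ∂μ - ∫ x, s x * h x ∂μ) := by
    rw [integral_add hspi hdi, integral_const_mul,
      integral_sub hfhi hshi, hs1]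
  have hpk : 0 < p * k := by positivity
  have hmono := integral_mono hfp hRi fun x => (htan x).1
  rw [hf1, hRint] at hmono
  refine ⟨?_, fun hle => ?_⟩
  · have : 0 ≤ p * k * (∫ x, f x * h x ∂μ - ∫ x, s x * h x ∂μ) := by linarith
    linarith [nonneg_of_mul_nonneg_right this hpk]
  · have heq : ∫ x, f x ^ p ∂μ = ∫ x, (s x ^ p + p * k * (f x * h x - s x * h x)) ∂μ := by
      rw [hf1, hRint]
      nlinarith
    have hae := (integral_eq_iff_of_ae_le hfp hRi
      (Filter.Eventually.of_forall fun x => (htan x).1)).1 heq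
    filter_upwards [hae] with x hx
    exact (htan x).2 hx

end Minimizer

/-! ### Potentials of integrable functions -/

/-- The potential `ξ ↦ ∫ |1 - ξ · η̄| ^ ((α - Q) / 2) f(η) dη` of a real function. -/
def hlsPotential {n : ℕ} (α : ℝ) (f : CRSphere n → ℝ) (ξ : CRSphere n) : ℝ :=
  ∫ η, hlsKernel α ξ η * f η ∂(surfaceMeasure n)

section Potential

variable {n : ℕ} {α p : ℝ} {f g : CRSphere n → ℝ}

theorem integrable_hlsKernel_mul (hα : homDim n < α) (hf : Integrable f (surfaceMeasure n))
    (ξ : CRSphere n) : Integrable (fun η => hlsKernel α ξ η * f η) (surfaceMeasure n) :=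
  hf.bdd_mul (c := 2 ^ ((α - homDim n) / 2))
    (continuous_hlsKernel_right hα ξ).aestronglyMeasurable
    (Filter.Eventually.of_forall fun η => by
      rw [Real.norm_of_nonneg (hlsKernel_nonneg _ _)]
      exact hlsKernel_le hα ξ η)

theorem hlsPotential_nonneg (hf0 : ∀ ξ, 0 ≤ f ξ) (ξ : CRSphere n) : 0 ≤ hlsPotential α f ξ :=
  integral_nonneg fun η => mul_nonneg (hlsKernel_nonneg _ _) (hf0 η)

theorem hlsPotential_le (hα : homDim n < α) (hf0 : ∀ ξ, 0 ≤ f ξ)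
    (hf : Integrable f (surfaceMeasure n)) (ξ : CRSphere n) :
    hlsPotential α f ξ ≤ 2 ^ ((α - homDim n) / 2) * ∫ η, f η ∂(surfaceMeasure n) := by
  rw [← integral_const_mul]
  refine integral_mono (integrable_hlsKernel_mul hα hf ξ) (hf.const_mul _) fun η => ?_
  exact mul_le_mul_of_nonneg_right (hlsKernel_le hα ξ η) (hf0 η)

theorem continuous_hlsPotential (hα : homDim n < α) (hf : Integrable f (surfaceMeasure n)) :
    Continuous (hlsPotential α f) := by
  refine continuous_of_dominated (bound := fun η => 2 ^ ((α - homDim n) / 2) * ‖f η‖)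
    (fun ξ => (integrable_hlsKernel_mul hα hf ξ).aestronglyMeasurable) (fun ξ => ?_)
    (hf.norm.const_mul _) ?_
  · refine Filter.Eventually.of_forall fun η => ?_
    rw [norm_mul, Real.norm_of_nonneg (hlsKernel_nonneg _ _)]
    exact mul_le_mul_of_nonneg_right (hlsKernel_le hα ξ η) (norm_nonneg _)
  · refine Filter.Eventually.of_forall fun η => Continuous.mul ?_ continuous_const
    simp_rw [fun ξ => hlsKernel_comm (α := α) ξ η]
    exact continuous_hlsKernel_right hα η

theorem lintegralPotential_ofReal (hα : homDim n < α) (hf0 : ∀ ξ, 0 ≤ f ξ)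
    (hf : Integrable f (surfaceMeasure n)) (ξ : CRSphere n) :
    lintegralPotential α (fun η => ENNReal.ofReal (f η)) ξ
      = ENNReal.ofReal (hlsPotential α f ξ) := by
  rw [hlsPotential, ofReal_integral_eq_lintegral_ofReal (integrable_hlsKernel_mul hα hf ξ)
    (Filter.Eventually.of_forall fun η => mul_nonneg (hlsKernel_nonneg _ _) (hf0 η))]
  simp_rw [ENNReal.ofReal_mul (hlsKernel_nonneg _ _)]
  rfl

theorem integrable_mul_hlsPotential (hα : homDim n < α)
    (hf : Integrable f (surfaceMeasure n)) (hg : Integrable g (surfaceMeasure n)) :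
    Integrable (fun ξ => f ξ * hlsPotential α g ξ) (surfaceMeasure n) := by
  obtain ⟨D, hD⟩ :=
    isCompact_univ.exists_bound_of_continuousOn (continuous_hlsPotential hα hg).continuousOn
  exact hf.mul_bdd (c := D) (continuous_hlsPotential hα hg).aestronglyMeasurable
    (Filter.Eventually.of_forall fun x => hD x trivial)

theorem hlsEnergy_eq_ofReal (hα : homDim n < α) (hf0 : ∀ ξ, 0 ≤ f ξ) (hg0 : ∀ ξ, 0 ≤ g ξ)
    (hf : Integrable f (surfaceMeasure n)) (hg : Integrable g (surfaceMeasure n)) :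
    hlsEnergy α f g = ENNReal.ofReal (∫ ξ, f ξ * hlsPotential α g ξ ∂(surfaceMeasure n)) := by
  rw [hlsEnergy_eq_lintegral_mul hf0, ofReal_integral_eq_lintegral_ofReal
    (integrable_mul_hlsPotential hα hf hg)
    (Filter.Eventually.of_forall fun ξ => mul_nonneg (hf0 ξ) (hlsPotential_nonneg hg0 ξ))]
  refine lintegral_congr fun ξ => ?_
  rw [lintegralPotential_ofReal hα hg0 hg, ENNReal.ofReal_mul (hf0 ξ)]

theorem IsNormalized.integrable_rpow (hp0 : 0 < p) (hf : IsNormalized p f) :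
    Integrable (fun ξ => f ξ ^ p) (surfaceMeasure n) := by
  refine ⟨(hf.aemeasurable.pow_const p).aestronglyMeasurable, ?_⟩
  rw [hasFiniteIntegral_iff_ofReal
    (Filter.Eventually.of_forall fun ξ => Real.rpow_nonneg (hf.1 ξ) p)]
  simp_rw [← ENNReal.ofReal_rpow_of_nonneg (hf.1 _) hp0.le]
  rw [hf.lintegral_rpow_eq_one hp0]
  exact ENNReal.one_lt_top

theorem IsNormalized.integral_rpow (hp0 : 0 < p) (hf : IsNormalized p f) :
    ∫ ξ, f ξ ^ p ∂(surfaceMeasure n) = 1 := by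
  rw [integral_eq_lintegral_of_nonneg_ae
    (Filter.Eventually.of_forall fun ξ => Real.rpow_nonneg (hf.1 ξ) p)
    (hf.integrable_rpow hp0).1]
  simp_rw [← ENNReal.ofReal_rpow_of_nonneg (hf.1 _) hp0.le]
  rw [hf.lintegral_rpow_eq_one hp0, ENNReal.toReal_one]

theorem isNormalized_of_continuous (hp0 : 0 < p) (hf : Continuous f) (hf0 : ∀ ξ, 0 ≤ f ξ)
    (h1 : ∫ ξ, f ξ ^ p ∂(surfaceMeasure n) = 1) : IsNormalized p f := by
  have hfp : Continuous fun ξ => f ξ ^ p := hf.rpow_const fun _ => Or.inr hp0.le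
  have hn : eLpNorm f (ENNReal.ofReal p) (surfaceMeasure n) = 1 := by
    rw [eLpNorm_ofReal_eq hp0 hf0]
    simp_rw [ENNReal.ofReal_rpow_of_nonneg (hf0 _) hp0.le]
    rw [← ofReal_integral_eq_lintegral_ofReal hfp.integrable_of_compactSpace
      (Filter.Eventually.of_forall fun ξ => Real.rpow_nonneg (hf0 ξ) p), h1]
    simp
  refine ⟨hf0, ⟨hf.aestronglyMeasurable, ?_⟩, hn⟩
  rw [hn]
  exact ENNReal.one_lt_top

theorem isNormalized_rpowMinimizer (hp0 : 0 < p) {h : CRSphere n → ℝ} (hh : Continuous h)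
    (hpos : ∀ ξ, 0 < h ξ) : IsNormalized p (rpowMinimizer (surfaceMeasure n) p h) :=
  isNormalized_of_continuous hp0 (continuous_rpowMinimizer hh hpos)
    (fun ξ => (rpowMinimizer_pos (surfaceMeasure_univ_ne_zero n) hh hpos ξ).le)
    (integral_rpowMinimizer_rpow (surfaceMeasure_univ_ne_zero n) hp0 hh hpos)

theorem hlsConst_le (hf : IsNormalized p f) (hg : IsNormalized p g) :
    hlsConst n α p ≤ hlsEnergy α f g :=
  iInf_le_of_le f (iInf_le_of_le g (iInf_le_of_le hf (iInf_le_of_le hg le_rfl)))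

theorem hlsConst_ne_top (hα : homDim n < α) (hp0 : 0 < p) : hlsConst n α p ≠ ⊤ := by
  have h1 : Continuous fun _ : CRSphere n => (1 : ℝ) := continuous_const
  have hN := isNormalized_rpowMinimizer hp0 h1 (fun _ => one_pos)
  have hi := (continuous_rpowMinimizer (μ := surfaceMeasure n) (p := p) h1
    (fun _ => one_pos)).integrable_of_compactSpace (μ := surfaceMeasure n)
  refine ((hlsConst_le hN hN).trans_lt ?_).ne
  rw [hlsEnergy_eq_ofReal hα hN.1 hN.1 hi hi]
  exact ENNReal.ofReal_lt_top

theorem exists_hlsEnergy_le (hα : homDim n < α) (hp0 : 0 < p) :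
    ∃ f g : CRSphere n → ℝ, IsNormalized p f ∧ IsNormalized p g ∧
      hlsEnergy α f g ≤ hlsConst n α p + 1 := by
  have h := ENNReal.lt_add_right (hlsConst_ne_top hα hp0) one_ne_zero
  conv_lhs at h => unfold hlsConst
  simp only [iInf_lt_iff] at h
  obtain ⟨f, g, hf, hg, hlt⟩ := h
  exact ⟨f, g, hf, hg, hlt.le⟩

/-- The a priori bounds for pairs whose energy exceeds the infimum by at most `1`. -/
theorem exists_bounds_of_hlsEnergy_le_hlsConst_add_one (hα : homDim n < α) (hp0 : 0 < p)
    (hp : p < critExp n α) :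
    ∃ M c : ℝ, 0 < M ∧ 0 < c ∧ ∀ f g : CRSphere n → ℝ, IsNormalized p f → IsNormalized p g →
      hlsEnergy α f g ≤ hlsConst n α p + 1 →
      (Integrable f (surfaceMeasure n) ∧ ∫ ξ, f ξ ∂(surfaceMeasure n) ≤ M ∧
        ∀ ξ, c ≤ hlsPotential α f ξ) ∧
      (Integrable g (surfaceMeasure n) ∧ ∫ ξ, g ξ ∂(surfaceMeasure n) ≤ M ∧
        ∀ ξ, c ≤ hlsPotential α g ξ) := by
  obtain ⟨M, c, hM, hc, H⟩ :=
    exists_bounds_of_hlsEnergy_le hα hp0 hp (hlsConst n α p + 1).toReal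
  have aux : ∀ f : CRSphere n → ℝ, IsNormalized p f →
      ∫⁻ ξ, ENNReal.ofReal (f ξ) ∂(surfaceMeasure n) ≤ ENNReal.ofReal M →
      (∀ ξ, ENNReal.ofReal c ≤ lintegralPotential α (fun η => ENNReal.ofReal (f η)) ξ) →
      (Integrable f (surfaceMeasure n) ∧ ∫ ξ, f ξ ∂(surfaceMeasure n) ≤ M ∧
        ∀ ξ, c ≤ hlsPotential α f ξ) := by
    intro f hf h1 h2
    have hi : Integrable f (surfaceMeasure n) := by
      refine ⟨hf.2.1.1, ?_⟩
      rw [hasFiniteIntegral_iff_ofReal (Filter.Eventually.of_forall hf.1)]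
      exact h1.trans_lt ENNReal.ofReal_lt_top
    refine ⟨hi, ?_, fun ξ => ?_⟩
    · rw [← ofReal_integral_eq_lintegral_ofReal hi (Filter.Eventually.of_forall hf.1),
        ENNReal.ofReal_le_ofReal_iff hM.le] at h1
      exact h1
    · have := h2 ξ
      rw [lintegralPotential_ofReal hα hf.1 hi,
        ENNReal.ofReal_le_ofReal_iff (hlsPotential_nonneg hf.1 ξ)] at this
      exact this
  refine ⟨M, c, hM, hc, fun f g hf hg hE => ?_⟩
  rw [← ENNReal.ofReal_toReal (ENNReal.add_ne_top.2 ⟨hlsConst_ne_top hα hp0, ENNReal.one_ne_top⟩)]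
    at hE
  obtain ⟨h1, h2, h3, h4⟩ := H f g hf hg hE
  exact ⟨aux f hf h1 h3, aux g hg h2 h4⟩

/-- Replacing `f` by the minimizer of `∫ f K g` does not increase the energy. -/
theorem hlsEnergy_rpowMinimizer_le (hα : homDim n < α) (hp0 : 0 < p) (hp1 : p < 1)
    (hf : IsNormalized p f) (hfi : Integrable f (surfaceMeasure n))
    (hg : IsNormalized p g) (hgi : Integrable g (surfaceMeasure n))
    (hpos : ∀ ξ, 0 < hlsPotential α g ξ) :
    hlsEnergy α (rpowMinimizer (surfaceMeasure n) p (hlsPotential α g)) g ≤ hlsEnergy α f g := by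
  have hc := continuous_hlsPotential hα hgi
  rw [hlsEnergy_eq_ofReal hα hf.1 hg.1 hfi hgi,
    hlsEnergy_eq_ofReal hα (isNormalized_rpowMinimizer hp0 hc hpos).1 hg.1
      (continuous_rpowMinimizer hc hpos).integrable_of_compactSpace hgi]
  exact ENNReal.ofReal_le_ofReal (integral_rpowMinimizer_mul_le (surfaceMeasure_univ_ne_zero n)
    hp0 hp1 hc hpos hf.1 hfi (hf.integrable_rpow hp0) (hf.integral_rpow hp0)).1

/-- The Euler–Lagrange equation: for given `g` the minimal `f` is unique almost everywhere, hence
everywhere by continuity. -/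
theorem eulerLagrange_of_continuous (hα : homDim n < α) (hp0 : 0 < p) (hp1 : p < 1)
    (hf : IsNormalized p f) (hfc : Continuous f) (hg : IsNormalized p g)
    (hgc : Continuous g) (hpos : ∀ ξ, 0 < hlsPotential α g ξ)
    (hmin : hlsConst n α p = hlsEnergy α f g) (ξ : CRSphere n) :
    0 < f ξ ∧ (hlsConst n α p).toReal * f ξ ^ (p - 1) = hlsPotential α g ξ := by
  have hgi := hgc.integrable_of_compactSpace (μ := surfaceMeasure n)
  have hfi := hfc.integrable_of_compactSpace (μ := surfaceMeasure n)
  have hc := continuous_hlsPotential hα hgi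
  have hμ := surfaceMeasure_univ_ne_zero n
  have hN := isNormalized_rpowMinimizer hp0 hc hpos
  have hsc := continuous_rpowMinimizer (μ := surfaceMeasure n) (p := p) hc hpos
  have hint := fun (u : CRSphere n → ℝ) (hu : ∀ ξ, 0 ≤ u ξ) =>
    integral_nonneg (μ := surfaceMeasure n) (f := fun ξ =>
    u ξ * hlsPotential α g ξ) fun ξ => mul_nonneg (hu ξ) (hpos ξ).le
  have hle : hlsEnergy α f g ≤
      hlsEnergy α (rpowMinimizer (surfaceMeasure n) p (hlsPotential α g)) g :=
    hmin ▸ hlsConst_le hN hg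
  rw [hlsEnergy_eq_ofReal hα hf.1 hg.1 hfi hgi,
    hlsEnergy_eq_ofReal hα hN.1 hg.1 hsc.integrable_of_compactSpace hgi,
    ENNReal.ofReal_le_ofReal_iff (hint _ hN.1)] at hle
  have hae := (integral_rpowMinimizer_mul_le hμ hp0 hp1 hc hpos hf.1 hfi
    (hf.integrable_rpow hp0) (hf.integral_rpow hp0)).2 hle
  have heq : f = rpowMinimizer (surfaceMeasure n) p (hlsPotential α g) :=
    (hfc.ae_eq_iff_eq _ hsc).1 hae
  have hfpos : ∀ ξ, 0 < f ξ := fun ξ => heq ▸ rpowMinimizer_pos hμ hc hpos ξ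
  obtain ⟨k, hk0, hk⟩ := rpowMinimizer_rpow_sub_one hμ hp1 hc hpos
  rw [← heq] at hk
  -- the multiplier is found by integrating against `f`
  have hkN : k * ∫ ξ, f ξ * hlsPotential α g ξ ∂(surfaceMeasure n) = 1 := by
    rw [← integral_const_mul]
    refine Eq.trans ?_ (hf.integral_rpow hp0)
    refine integral_congr_ae (Filter.Eventually.of_forall fun ξ => ?_)
    have h1 : f ξ ^ p = f ξ ^ (p - 1) * f ξ := by
      rw [← Real.rpow_add_one (hfpos ξ).ne', sub_add_cancel]
    simp only [h1, hk]
    ring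
  have hNv : (hlsConst n α p).toReal = ∫ ξ, f ξ * hlsPotential α g ξ ∂(surfaceMeasure n) := by
    rw [hmin, hlsEnergy_eq_ofReal hα hf.1 hg.1 hfi hgi, ENNReal.toReal_ofReal (hint _ hf.1)]
  refine ⟨hfpos ξ, ?_⟩
  rw [hNv, hk, ← mul_assoc, mul_comm _ k, hkN, one_mul]

end Potential

/-! ### Existence of continuous minimizers -/

/-- A form of the Arzelà–Ascoli theorem: bounded families with a common modulus of continuity are
compact. -/
theorem isCompact_setOf_bounded_modulus {X : Type*} [TopologicalSpace X] [CompactSpace X]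
    {w : X → X → ℝ} (hw : ∀ x, Continuous (w x)) (hw0 : ∀ x, w x x = 0) (a b : ℝ) :
    IsCompact {φ : C(X, ℝ) | (∀ x, φ x ∈ Set.Icc a b) ∧ ∀ x y, |φ x - φ y| ≤ w x y} := by
  set A := {φ : C(X, ℝ) | (∀ x, φ x ∈ Set.Icc a b) ∧ ∀ x y, |φ x - φ y| ≤ w x y} with hA
  have hequi : ∀ φ : X → ℝ, (∀ x y, |φ x - φ y| ≤ w x y) → Continuous φ := by
    intro φ hφ
    refine continuous_iff_continuousAt.2 fun x => tendsto_iff_dist_tendsto_zero.2 ?_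
    refine squeeze_zero (fun _ => dist_nonneg) (fun y => ?_) (g := w x) ?_
    · rw [dist_comm, Real.dist_eq]
      exact hφ x y
    · simpa [hw0] using (hw x).tendsto x
  have himg : ContinuousMap.toFun '' A =
      Set.univ.pi (fun _ => Set.Icc a b) ∩ {φ : X → ℝ | ∀ x y, |φ x - φ y| ≤ w x y} := by
    ext φ
    constructor
    · rintro ⟨ψ, hψ, rfl⟩
      exact ⟨fun x _ => hψ.1 x, hψ.2⟩
    · rintro ⟨h1, h2⟩
      exact ⟨⟨φ, hequi φ h2⟩, ⟨fun x => h1 x trivial, h2⟩, rfl⟩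
  refine ArzelaAscoli.isCompact_of_equicontinuous A ?_ ?_
  · rw [himg]
    refine (isCompact_univ_pi fun _ => isCompact_Icc).inter_right ?_
    simp only [Set.ofPred_forall]
    refine isClosed_iInter fun x => isClosed_iInter fun y => ?_
    exact isClosed_le (by fun_prop) continuous_const
  · intro x
    rw [Metric.equicontinuousAt_iff_right]
    intro ε hε
    have := ((hw x).tendsto x).eventually_lt_const (show w x x < ε by rwa [hw0])
    filter_upwards [this] with y hy φ
    rw [Real.dist_eq]
    exact (φ.2.2 x y).trans_lt hy

theorem ContinuousMap.continuous_integral {X : Type*} [TopologicalSpace X] [CompactSpace X]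
    [MeasurableSpace X] [BorelSpace X] (μ : Measure X) [IsFiniteMeasure μ] :
    Continuous fun φ : C(X, ℝ) => ∫ x, φ x ∂μ := by
  refine (LipschitzWith.of_dist_le_mul (K := (μ.real Set.univ).toNNReal) fun φ ψ => ?_).continuous
  rw [dist_eq_norm, ← integral_sub φ.continuous.integrable_of_compactSpace
    ψ.continuous.integrable_of_compactSpace, Real.coe_toNNReal _ measureReal_nonneg, mul_comm]
  refine norm_integral_le_of_norm_le_const (Filter.Eventually.of_forall fun x => ?_)
  rw [← dist_eq_norm]
  exact ContinuousMap.dist_apply_le_dist x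

/-- The map `h ↦ rpowMinimizer μ p (max h c)` on continuous functions; the truncation makes it
defined and continuous everywhere. -/
def truncatedRpowMinimizer {X : Type*} [TopologicalSpace X] [MeasurableSpace X] (μ : Measure X)
    (p : ℝ) {c : ℝ} (hc : 0 < c) (h : C(X, ℝ)) : C(X, ℝ) :=
  ⟨rpowMinimizer μ p fun x => max (h x) c, continuous_rpowMinimizer (h.continuous.max
    continuous_const) fun _ => lt_max_of_lt_right hc⟩

theorem continuous_truncatedRpowMinimizer {X : Type*} [TopologicalSpace X] [CompactSpace X]
    [MeasurableSpace X] [BorelSpace X] {μ : Measure X} [IsFiniteMeasure μ] (hμ : μ Set.univ ≠ 0)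
    (p : ℝ) {c : ℝ} (hc : 0 < c) : Continuous (truncatedRpowMinimizer μ p hc) := by
  have hpos : ∀ t : ℝ, 0 < max t c := fun t => lt_max_of_lt_right hc
  let P : ℝ → C(ℝ, ℝ) := fun r => ⟨fun t => max t c ^ r,
    (continuous_id.max continuous_const).rpow_const_of_pos hpos r⟩
  have hP : ∀ r, Continuous fun h : C(X, ℝ) => (P r).comp h := fun r =>
    ContinuousMap.continuous_postcomp (P r)
  have hI : Continuous fun h : C(X, ℝ) => ∫ x, max (h x) c ^ (p / (p - 1)) ∂μ :=
    (ContinuousMap.continuous_integral μ).comp (hP (p / (p - 1)))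
  have hI0 : ∀ h : C(X, ℝ), 0 < ∫ x, max (h x) c ^ (p / (p - 1)) ∂μ := fun h =>
    integral_rpow_pos hμ (h.continuous.max continuous_const) (fun x => hpos _) _
  have : truncatedRpowMinimizer μ p hc = fun h : C(X, ℝ) =>
      (∫ x, max (h x) c ^ (p / (p - 1)) ∂μ) ^ (-(1 / p)) • (P (1 / (p - 1))).comp h := by
    funext h
    ext x
    rfl
  rw [this]
  exact (hI.rpow_const_of_pos hI0 _).smul (hP _)

section Existence

variable {n : ℕ} {α p : ℝ}

theorem continuous_integral_mul_hlsPotential (hα : homDim n < α) :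
    Continuous fun z : C(CRSphere n, ℝ) × C(CRSphere n, ℝ) =>
      ∫ ξ, z.1 ξ * hlsPotential α z.2 ξ ∂(surfaceMeasure n) := by
  let K : C(CRSphere n × CRSphere n, ℝ) := ⟨_, continuous_hlsKernel hα⟩
  have h1 : Continuous fun z : C(CRSphere n, ℝ) × C(CRSphere n, ℝ) =>
      (z.1.comp ContinuousMap.fst) * (K * z.2.comp ContinuousMap.snd) := by
    refine ((ContinuousMap.continuous_precomp _).comp continuous_fst).mul
      (continuous_const.mul ((ContinuousMap.continuous_precomp _).comp continuous_snd))
  have h2 := (ContinuousMap.continuous_integral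
    ((surfaceMeasure n).prod (surfaceMeasure n))).comp h1
  convert h2 using 1
  funext z
  have hi := ((z.1.comp ContinuousMap.fst) * (K * z.2.comp ContinuousMap.snd)
    ).continuous.integrable_of_compactSpace (μ := (surfaceMeasure n).prod (surfaceMeasure n))
  refine Eq.trans ?_ (integral_prod _ hi).symm
  refine integral_congr_ae (Filter.Eventually.of_forall fun ξ => ?_)
  simp only [hlsPotential]
  rw [← integral_const_mul]
  rfl

/-- The distance of the kernels with poles `ξ` and `ξ'`; a modulus of continuity for
potentials. -/
def kernelModulus (hα : homDim n < α) (ξ ξ' : CRSphere n) : ℝ :=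
  dist ((⟨_, continuous_hlsKernel hα⟩ : C(CRSphere n × CRSphere n, ℝ)).curry ξ)
    ((⟨_, continuous_hlsKernel hα⟩ : C(CRSphere n × CRSphere n, ℝ)).curry ξ')

theorem abs_hlsPotential_sub_le (hα : homDim n < α) {f : CRSphere n → ℝ} (hf0 : ∀ ξ, 0 ≤ f ξ)
    (hf : Integrable f (surfaceMeasure n)) (ξ ξ' : CRSphere n) :
    |hlsPotential α f ξ - hlsPotential α f ξ'| ≤
      (∫ η, f η ∂(surfaceMeasure n)) * kernelModulus hα ξ ξ' := by
  rw [hlsPotential, hlsPotential, ← integral_sub (integrable_hlsKernel_mul hα hf ξ)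
    (integrable_hlsKernel_mul hα hf ξ'), ← Real.norm_eq_abs, ← integral_mul_const]
  refine norm_integral_le_of_norm_le (hf.mul_const _) (Filter.Eventually.of_forall fun η => ?_)
  rw [← sub_mul, norm_mul, Real.norm_of_nonneg (hf0 η), mul_comm]
  refine mul_le_mul_of_nonneg_left ?_ (hf0 η)
  rw [← dist_eq_norm]
  exact ContinuousMap.dist_apply_le_dist (f := (⟨_, continuous_hlsKernel hα⟩ :
    C(CRSphere n × CRSphere n, ℝ)).curry ξ) (g := (⟨_, continuous_hlsKernel hα⟩ :
    C(CRSphere n × CRSphere n, ℝ)).curry ξ') η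

/-- By `hlsEnergy_rpowMinimizer_le` it is enough to minimize over pairs of functions
`f = rpowMinimizer σ p h`, where `h` is a potential. The a priori bounds place these `h` in a
compact set of continuous functions on which the energy is continuous. -/
theorem exists_continuous_minimizer (hα : homDim n < α) (hp0 : 0 < p) (hp : p < critExp n α) :
    ∃ f g : CRSphere n → ℝ, Continuous f ∧ Continuous g ∧ IsNormalized p f ∧ IsNormalized p g ∧
      hlsConst n α p = hlsEnergy α f g := by
  have hp1 := hp.trans (critExp_lt_one hα)
  set σ := surfaceMeasure n
  have hσ : σ Set.univ ≠ 0 := surfaceMeasure_univ_ne_zero n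
  obtain ⟨M, c, hM, hc, hb⟩ := exists_bounds_of_hlsEnergy_le_hlsConst_add_one hα hp0 hp
  set D : ℝ := 2 ^ ((α - homDim n) / 2) * M
  let A : Set C(CRSphere n, ℝ) := {φ | (∀ x, φ x ∈ Set.Icc c D) ∧
    ∀ x y, |φ x - φ y| ≤ M * kernelModulus hα x y}
  have hA : IsCompact A := by
    refine isCompact_setOf_bounded_modulus (w := fun x y => M * kernelModulus hα x y)
      (fun x => ?_) (fun x => ?_) c D
    · unfold kernelModulus
      exact continuous_const.mul (continuous_const.dist (ContinuousMap.continuous _))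
    · simp [kernelModulus]
  let T := truncatedRpowMinimizer σ p hc
  have hT : Continuous T := continuous_truncatedRpowMinimizer hσ p hc
  let Φ : C(CRSphere n, ℝ) × C(CRSphere n, ℝ) → ℝ := fun z =>
    ∫ ξ, T z.1 ξ * hlsPotential α (T z.2) ξ ∂σ
  have hΦ : Continuous Φ := (continuous_integral_mul_hlsPotential hα).comp (hT.prodMap hT)
  have hTN : ∀ h, IsNormalized p (T h) := fun h => isNormalized_rpowMinimizer hp0
    (h.continuous.max continuous_const) fun _ => lt_max_of_lt_right hc
  have hΦE : ∀ z, hlsEnergy α (T z.1) (T z.2) = ENNReal.ofReal (Φ z) := fun z =>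
    hlsEnergy_eq_ofReal hα (hTN _).1 (hTN _).1 (T z.1).continuous.integrable_of_compactSpace
      (T z.2).continuous.integrable_of_compactSpace
  -- potentials of admissible functions lie in `A`
  have hmem : ∀ (g : CRSphere n → ℝ) (hg : IsNormalized p g) (hgi : Integrable g σ),
      ∫ ξ, g ξ ∂σ ≤ M → (∀ ξ, c ≤ hlsPotential α g ξ) →
      (⟨_, continuous_hlsPotential hα hgi⟩ : C(CRSphere n, ℝ)) ∈ A := by
    intro g hg hgi hgM hgc
    refine ⟨fun ξ => ⟨hgc ξ, ?_⟩, fun ξ ξ' => ?_⟩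
    · exact (hlsPotential_le hα hg.1 hgi ξ).trans
        (mul_le_mul_of_nonneg_left hgM (by positivity))
    · exact (abs_hlsPotential_sub_le hα hg.1 hgi ξ ξ').trans
        (mul_le_mul_of_nonneg_right hgM dist_nonneg)
  have hTeq : ∀ (g : CRSphere n → ℝ) (hgi : Integrable g σ) (_ : ∀ ξ, c ≤ hlsPotential α g ξ),
      (T ⟨_, continuous_hlsPotential hα hgi⟩ : CRSphere n → ℝ)
        = rpowMinimizer σ p (hlsPotential α g) := by
    intro g hgi hgc
    change rpowMinimizer σ p (fun x => max (hlsPotential α g x) c) = _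
    congr 1
    funext x
    exact max_eq_left (hgc x)
  have hred : ∀ f g : CRSphere n → ℝ, IsNormalized p f → IsNormalized p g →
      hlsEnergy α f g ≤ hlsConst n α p + 1 →
      ∃ z ∈ A ×ˢ A, hlsEnergy α (T z.1) (T z.2) ≤ hlsEnergy α f g := by
    intro f g hf hg hE
    obtain ⟨⟨hfi, -, -⟩, hgi, hgM, hgc⟩ := hb f g hf hg hE
    let h₁ : C(CRSphere n, ℝ) := ⟨_, continuous_hlsPotential hα hgi⟩
    have hE₁ : hlsEnergy α (T h₁) g ≤ hlsEnergy α f g := by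
      rw [hTeq g hgi hgc]
      exact hlsEnergy_rpowMinimizer_le hα hp0 hp1 hf hfi hg hgi fun ξ => hc.trans_le (hgc ξ)
    obtain ⟨⟨hfi', hfM, hfc⟩, -⟩ := hb (T h₁) g (hTN h₁) hg (hE₁.trans hE)
    let h₂ : C(CRSphere n, ℝ) := ⟨_, continuous_hlsPotential hα hfi'⟩
    have hE₂ : hlsEnergy α (T h₁) (T h₂) ≤ hlsEnergy α (T h₁) g := by
      rw [hlsEnergy_comm hα (hTN h₁).aemeasurable (hTN h₂).aemeasurable,
        hlsEnergy_comm hα (hTN h₁).aemeasurable hg.aemeasurable, hTeq (T h₁) hfi' hfc]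
      exact hlsEnergy_rpowMinimizer_le hα hp0 hp1 hg hgi (hTN h₁) hfi'
        fun ξ => hc.trans_le (hfc ξ)
    exact ⟨(h₁, h₂), ⟨hmem g hg hgi hgM hgc, hmem _ (hTN h₁) hfi' hfM hfc⟩, hE₂.trans hE₁⟩
  obtain ⟨f₀, g₀, hf₀, hg₀, hE₀⟩ := exists_hlsEnergy_le hα hp0 (n := n) (α := α)
  obtain ⟨z₀, hz₀, hz₀E⟩ := hred f₀ g₀ hf₀ hg₀ hE₀
  obtain ⟨z, -, hzmin⟩ := (hA.prod hA).exists_isMinOn ⟨z₀, hz₀⟩ hΦ.continuousOn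
  have hzle : ∀ z' ∈ A ×ˢ A, hlsEnergy α (T z.1) (T z.2) ≤ hlsEnergy α (T z'.1) (T z'.2) := by
    intro z' hz'
    rw [hΦE, hΦE]
    exact ENNReal.ofReal_le_ofReal (hzmin hz')
  refine ⟨T z.1, T z.2, (T z.1).continuous, (T z.2).continuous, hTN _, hTN _,
    le_antisymm (hlsConst_le (hTN _) (hTN _)) ?_⟩
  refine le_iInf fun f => le_iInf fun g => le_iInf fun hf => le_iInf fun hg => ?_
  rcases le_total (hlsEnergy α f g) (hlsConst n α p + 1) with hE | hE
  · obtain ⟨z', hz', hz'E⟩ := hred f g hf hg hE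
    exact (hzle z' hz').trans hz'E
  · exact (hzle z₀ hz₀).trans (hz₀E.trans (hE₀.trans hE))

end Existence

/-! ### First order Taylor expansion of `|w| ^ r` -/

theorem Real.exists_abs_rpow_sub_taylor_le (a : ℝ) :
    ∃ L : ℝ, 0 ≤ L ∧ ∀ x ∈ Set.Icc (1 / 4 : ℝ) (9 / 4),
      |x ^ a - 1 - a * (x - 1)| ≤ L * (x - 1) ^ 2 := by
  set I := Set.Icc (1 / 4 : ℝ) (9 / 4) with hI
  have hI0 : ∀ x ∈ I, x ≠ 0 := fun x hx => by have := hx.1; linarith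
  have h1I : (1 : ℝ) ∈ I := by norm_num [hI]
  have hcont : ContinuousOn (fun x : ℝ => a * ((a - 1) * x ^ (a - 1 - 1))) I :=
    continuousOn_const.mul (continuousOn_const.mul
      (continuousOn_id.rpow_const fun x hx => Or.inl (hI0 x hx)))
  obtain ⟨L, hL⟩ := isCompact_Icc.exists_bound_of_continuousOn hcont
  have hL0 : 0 ≤ L := (norm_nonneg _).trans (hL 1 h1I)
  -- the derivative of the remainder is Lipschitz with constant `L`
  have hd : ∀ x ∈ I, |a * x ^ (a - 1) - a| ≤ L * |x - 1| := by
    intro x hx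
    have := (convex_Icc (1 / 4 : ℝ) (9 / 4)).norm_image_sub_le_of_norm_hasDerivWithin_le
      (f := fun x => a * x ^ (a - 1))
      (fun y hy => (((Real.hasDerivAt_rpow_const (p := a - 1)
        (Or.inl (hI0 y hy))).const_mul a).hasDerivWithinAt)) hL h1I hx
    simpa using this
  refine ⟨L, hL0, fun x hx => ?_⟩
  have hsub : Set.uIcc 1 x ⊆ I := Set.uIcc_subset_Icc h1I hx
  have := (convex_uIcc (1 : ℝ) x).norm_image_sub_le_of_norm_hasDerivWithin_le
    (f := fun y => y ^ a - 1 - a * (y - 1)) (f' := fun y => a * y ^ (a - 1) - a)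
    (C := L * |x - 1|) (x := 1) (y := x) (fun y hy => by
      have h1 := ((Real.hasDerivAt_rpow_const (p := a) (Or.inl (hI0 y (hsub hy)))).sub_const 1).sub
        (((hasDerivAt_id y).sub_const 1).const_mul a)
      rw [mul_one] at h1
      exact h1.hasDerivWithinAt) (fun y hy => (hd y (hsub hy)).trans
        (mul_le_mul_of_nonneg_left (Set.abs_sub_left_of_mem_uIcc hy) hL0))
      Set.left_mem_uIcc Set.right_mem_uIcc
  simp only [Real.one_rpow, sub_self, mul_zero, sub_zero, Real.norm_eq_abs] at this
  rwa [mul_assoc, abs_mul_abs_self, ← sq] at this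

/-- The remainder in the first order expansion of `|w| ^ r` is `O(|v|² (|w| ^ (r - 2) + 1))`, also
when the increment `v` is not small compared with `w`. -/
theorem Complex.exists_abs_norm_rpow_sub_taylor_le {r : ℝ} (hr : 0 < r) :
    ∃ C : ℝ, 0 ≤ C ∧ ∀ w v : ℂ, w ≠ 0 → ‖v‖ ≤ 1 →
      |‖w + v‖ ^ r - ‖w‖ ^ r - r * ‖w‖ ^ (r - 2) * (conj w * v).re|
        ≤ C * ‖v‖ ^ 2 * (‖w‖ ^ (r - 2) + 1) := by
  obtain ⟨L, hL0, hL⟩ := Real.exists_abs_rpow_sub_taylor_le (r / 2)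
  refine ⟨9 * L + r / 2 + 4 * 3 ^ r + 4 * 2 ^ r + 2 * r, by positivity, fun w v hw hv => ?_⟩
  have hwn : 0 < ‖w‖ := norm_pos_iff.2 hw
  have hw2 : ‖w‖ ^ (r - 2) * ‖w‖ ^ 2 = ‖w‖ ^ r := by
    rw [← Real.rpow_natCast, ← Real.rpow_add hwn]; congr 1; push_cast; ring
  set ρ := ‖w‖ ^ (r - 2) with hρ
  have hρ0 : 0 < ρ := by positivity
  have hre : |(conj w * v).re| ≤ ‖w‖ * ‖v‖ := by
    simpa using Complex.abs_re_le_norm (conj w * v)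
  have h3 : (0 : ℝ) < 3 ^ r := by positivity
  have h2 : (0 : ℝ) < 2 ^ r := by positivity
  rcases lt_or_ge ‖v‖ (‖w‖ / 2) with hlt | hge
  · -- `|w + v|² = |w|² (1 + τ)` with `|τ| ≤ 3 |v| / |w|`
    have hsq : ‖w + v‖ ^ 2 = ‖w‖ ^ 2 + 2 * (conj w * v).re + ‖v‖ ^ 2 := by
      rw [Complex.sq_norm, Complex.normSq_add, ← Complex.sq_norm, ← Complex.sq_norm]
      have : (w * conj v).re = (conj w * v).re := by simp [Complex.mul_re]
      rw [this]; ring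
    set x := ‖w + v‖ ^ 2 / ‖w‖ ^ 2 with hx
    have hx1 : (x - 1) * ‖w‖ ^ 2 = 2 * (conj w * v).re + ‖v‖ ^ 2 := by
      rw [hx, sub_mul, div_mul_cancel₀ _ (by positivity), hsq]; ring
    have hle := norm_add_le w v
    have hge' : ‖w‖ - ‖v‖ ≤ ‖w + v‖ := by
      have := norm_sub_norm_le w (-v); rwa [norm_neg, sub_neg_eq_add] at this
    have hxI : x ∈ Set.Icc (1 / 4 : ℝ) (9 / 4) := by
      constructor
      · rw [hx, le_div_iff₀ (by positivity)]; nlinarith [norm_nonneg v]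
      · rw [hx, div_le_iff₀ (by positivity)]; nlinarith [norm_nonneg (w + v)]
    have hpow : ‖w + v‖ ^ r = ‖w‖ ^ r * x ^ (r / 2) := by
      have h1 : ∀ y : ℝ, 0 ≤ y → (y ^ 2) ^ (r / 2) = y ^ r := fun y hy => by
        rw [← Real.rpow_natCast, ← Real.rpow_mul hy]; congr 1; push_cast; ring
      rw [hx, Real.div_rpow (by positivity) (by positivity), h1 _ (norm_nonneg _),
        h1 _ (norm_nonneg _), mul_div_cancel₀ _ (by positivity)]
    have hτ : |x - 1| * ‖w‖ ≤ 3 * ‖v‖ := by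
      have h1 : |x - 1| * ‖w‖ ^ 2 ≤ 3 * ‖v‖ * ‖w‖ := by
        rw [show |x - 1| * ‖w‖ ^ 2 = |(x - 1) * ‖w‖ ^ 2| by
          rw [abs_mul, abs_of_nonneg (sq_nonneg ‖w‖)], hx1]
        refine (abs_add_le _ _).trans ?_
        rw [abs_mul, abs_two, abs_of_nonneg (sq_nonneg ‖v‖)]
        nlinarith [norm_nonneg v]
      have h2 : (|x - 1| * ‖w‖) * ‖w‖ ≤ (3 * ‖v‖) * ‖w‖ := by linarith
      exact le_of_mul_le_mul_right h2 hwn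
    have hτ2 : (x - 1) ^ 2 * ‖w‖ ^ 2 ≤ 9 * ‖v‖ ^ 2 := by
      rw [← sq_abs (x - 1)]
      nlinarith [abs_nonneg (x - 1), norm_nonneg v, mul_nonneg (abs_nonneg (x - 1)) hwn.le]
    have hmain : ‖w + v‖ ^ r - ‖w‖ ^ r - r * ρ * (conj w * v).re
        = ρ * ‖w‖ ^ 2 * (x ^ (r / 2) - 1 - r / 2 * (x - 1)) + r / 2 * ρ * ‖v‖ ^ 2 := by
      rw [hpow, ← hw2]
      linear_combination (r / 2 * ρ) * hx1
    rw [hmain]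
    refine (abs_add_le _ _).trans ?_
    rw [abs_mul, abs_of_pos (by positivity : 0 < ρ * ‖w‖ ^ 2),
      abs_of_nonneg (by positivity : 0 ≤ r / 2 * ρ * ‖v‖ ^ 2)]
    have h4 : ρ * ‖w‖ ^ 2 * |x ^ (r / 2) - 1 - r / 2 * (x - 1)| ≤ 9 * L * (ρ * ‖v‖ ^ 2) := by
      calc _ ≤ ρ * ‖w‖ ^ 2 * (L * (x - 1) ^ 2) := by gcongr; exact hL x hxI
        _ = ρ * L * ((x - 1) ^ 2 * ‖w‖ ^ 2) := by ring
        _ ≤ ρ * L * (9 * ‖v‖ ^ 2) := by gcongr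
        _ = _ := by ring
    calc _ ≤ 9 * L * (ρ * ‖v‖ ^ 2) + r / 2 * ρ * ‖v‖ ^ 2 := by gcongr
      _ = (9 * L + r / 2) * (‖v‖ ^ 2 * ρ) := by ring
      _ ≤ (9 * L + r / 2 + 4 * 3 ^ r + 4 * 2 ^ r + 2 * r) * (‖v‖ ^ 2 * (ρ + 1)) := by
          gcongr <;> nlinarith
      _ = _ := by ring
  · -- every term is `O(|v| ^ r)` or `O(|w| ^ (r - 1) |v|)`
    have hv0 : 0 < ‖v‖ := by linarith
    have hvr : ‖v‖ ^ r ≤ 4 * (‖v‖ ^ 2 * (ρ + 1)) := by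
      have h1 : ‖v‖ ^ r = ‖v‖ ^ 2 * ‖v‖ ^ (r - 2) := by
        rw [← Real.rpow_natCast, ← Real.rpow_add hv0]; congr 1; push_cast; ring
      have h4 : ‖v‖ ^ (r - 2) ≤ 4 * (ρ + 1) := by
        rcases le_total 2 r with h | h
        · have : ‖v‖ ^ (r - 2) ≤ 1 := Real.rpow_le_one hv0.le hv (by linarith)
          linarith
        · have h5 : ‖v‖ ^ (r - 2) ≤ (‖w‖ / 2) ^ (r - 2) :=
            Real.rpow_le_rpow_of_nonpos (by positivity) hge (by linarith)
          have h6 : (2 : ℝ) ^ (2 - r) ≤ 2 ^ (2 : ℝ) :=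
            Real.rpow_le_rpow_of_exponent_le (by norm_num) (by linarith)
          rw [Real.div_rpow hwn.le (by norm_num), div_eq_mul_inv, ← Real.rpow_neg (by norm_num),
            neg_sub, ← hρ] at h5
          norm_num at h6
          nlinarith
      rw [h1]
      nlinarith [sq_nonneg ‖v‖]
    have e1 : ‖w + v‖ ^ r ≤ 3 ^ r * ‖v‖ ^ r := by
      rw [← Real.mul_rpow (by norm_num) hv0.le]
      exact Real.rpow_le_rpow (norm_nonneg _) ((norm_add_le w v).trans (by linarith)) hr.le
    have e2 : ‖w‖ ^ r ≤ 2 ^ r * ‖v‖ ^ r := by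
      rw [← Real.mul_rpow (by norm_num) hv0.le]
      exact Real.rpow_le_rpow (norm_nonneg _) (by linarith) hr.le
    have e3 : |r * ρ * (conj w * v).re| ≤ 2 * r * (‖v‖ ^ 2 * (ρ + 1)) := by
      rw [abs_mul, abs_of_pos (by positivity : 0 < r * ρ)]
      calc r * ρ * |(conj w * v).re| ≤ r * ρ * (‖w‖ * ‖v‖) := by gcongr
        _ ≤ r * ρ * (2 * ‖v‖ * ‖v‖) := by gcongr; linarith
        _ ≤ _ := by nlinarith [mul_pos hr (pow_pos hv0 2)]
    have e4 : |‖w + v‖ ^ r - ‖w‖ ^ r - r * ρ * (conj w * v).re|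
        ≤ ‖w + v‖ ^ r + ‖w‖ ^ r + |r * ρ * (conj w * v).re| := by
      refine (abs_sub _ _).trans (add_le_add_left ((abs_sub _ _).trans (le_of_eq ?_)) _)
      rw [abs_of_nonneg (by positivity), abs_of_nonneg (by positivity)]
    refine e4.trans ?_
    have e5 := mul_le_mul_of_nonneg_left hvr h3.le
    have e6 := mul_le_mul_of_nonneg_left hvr h2.le
    have e7 : 0 ≤ (9 * L + r / 2) * (‖v‖ ^ 2 * (ρ + 1)) := by positivity
    nlinarith

/-! ### Functions with a quadratic first order expansion along the unit sphere -/

section Radial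

variable {E : Type*} [NormedAddCommGroup E] [InnerProductSpace ℝ E]

theorem contDiffOn_normalize : ContDiffOn ℝ 1 (fun x : E => ‖x‖⁻¹ • x) {0}ᶜ := by
  intro x hx
  have hx : x ≠ 0 := hx
  exact (((contDiffAt_norm ℝ hx).inv (norm_ne_zero_iff.2 hx)).smul
    contDiffAt_id).contDiffWithinAt

theorem norm_normalize {x : E} (hx : x ≠ 0) : ‖‖x‖⁻¹ • x‖ = 1 := by
  rw [norm_smul, norm_inv, norm_norm, inv_mul_cancel₀ (norm_ne_zero_iff.2 hx)]

variable {U : E → ℝ} {V : E → E →L[ℝ] ℝ} {C : ℝ}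

theorem hasFDerivAt_of_quadratic_remainder {x : E}
    (h : ∀ y : E, ‖y‖ ≤ 1 → |U (x + y) - U x - V x y| ≤ C * ‖y‖ ^ 2) :
    HasFDerivAt U (V x) x := by
  rw [hasFDerivAt_iff_isLittleO_nhds_zero]
  have hO : (fun y => U (x + y) - U x - V x y) =O[nhds 0] fun y : E => ‖y‖ ^ 2 := by
    refine Asymptotics.IsBigO.of_bound C ?_
    filter_upwards [Metric.closedBall_mem_nhds (0 : E) one_pos] with y hy
    rw [Real.norm_eq_abs, Real.norm_of_nonneg (by positivity)]
    exact h y (by simpa using hy)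
  exact hO.trans_isLittleO (Asymptotics.isLittleO_norm_pow_id one_lt_two)

/-- If the first order expansion of `U` has a quadratic remainder, uniformly at the points of the
unit sphere, then the derivative is Lipschitz along the sphere: compare the expansions of
`U (x + h)` at `x` and at `y` for `‖h‖ = ‖x - y‖`. -/
theorem norm_sub_le_of_quadratic_remainder
    (h : ∀ x : E, ‖x‖ = 1 → ∀ y : E, ‖y‖ ≤ 1 → |U (x + y) - U x - V x y| ≤ C * ‖y‖ ^ 2)
    {x y : E} (hx : ‖x‖ = 1) (hy : ‖y‖ = 1) (hxy : ‖x - y‖ ≤ 1 / 2) (hC : 0 ≤ C) :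
    ‖V x - V y‖ ≤ 6 * C * ‖x - y‖ := by
  rcases eq_or_ne x y with rfl | hne
  · simp
  set δ := ‖x - y‖ with hδ
  have hδ0 : 0 < δ := norm_pos_iff.2 (sub_ne_zero.2 hne)
  refine ContinuousLinearMap.opNorm_le_of_unit_norm (by positivity) fun u hu => ?_
  have hδu : ‖δ • u‖ = δ := by rw [norm_smul, hu, mul_one, Real.norm_of_nonneg hδ0.le]
  have hsum : ‖δ • u + (x - y)‖ ≤ 2 * δ := (norm_add_le _ _).trans (by rw [hδu]; linarith)
  have h1 := h x hx (δ • u) (by rw [hδu]; linarith)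
  have h2 := h y hy (δ • u + (x - y)) (by linarith)
  have h3 := h y hy (x - y) (by linarith)
  rw [show y + (δ • u + (x - y)) = x + δ • u by abel] at h2
  rw [show y + (x - y) = x by abel] at h3
  rw [hδu] at h1
  have h2' : C * ‖δ • u + (x - y)‖ ^ 2 ≤ C * (4 * δ ^ 2) := by
    refine mul_le_mul_of_nonneg_left ?_ hC
    nlinarith [norm_nonneg (δ • u + (x - y))]
  have h4 : |V x (δ • u) - V y (δ • u)| ≤ 6 * C * δ ^ 2 := by
    rw [map_add] at h2
    rw [abs_le] at h1 h2 h3 ⊢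
    constructor <;> linarith [h1.1, h1.2, h2.1, h2.2, h3.1, h3.2]
  rw [map_smul, map_smul, smul_eq_mul, smul_eq_mul, ← mul_sub, abs_mul, abs_of_pos hδ0] at h4
  rw [Real.norm_eq_abs, sub_apply]
  nlinarith

theorem contDiffOn_comp_normalize_of_quadratic_remainder (hC : 0 ≤ C)
    (h : ∀ x : E, ‖x‖ = 1 → ∀ y : E, ‖y‖ ≤ 1 → |U (x + y) - U x - V x y| ≤ C * ‖y‖ ^ 2) :
    ContDiffOn ℝ 1 (fun x : E => U (‖x‖⁻¹ • x)) {0}ᶜ ∧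
      ∀ x : E, x ≠ 0 → fderiv ℝ (fun x : E => U (‖x‖⁻¹ • x)) x
        = (V (‖x‖⁻¹ • x)).comp (fderiv ℝ (fun x : E => ‖x‖⁻¹ • x) x) := by
  have hopen : IsOpen ({0}ᶜ : Set E) := isOpen_compl_singleton
  have hder : ∀ x : E, x ≠ 0 → HasFDerivAt (fun x : E => U (‖x‖⁻¹ • x))
      ((V (‖x‖⁻¹ • x)).comp (fderiv ℝ (fun x : E => ‖x‖⁻¹ • x) x)) x := fun x hx => by
    have h1 : HasFDerivAt (fun x : E => ‖x‖⁻¹ • x) (fderiv ℝ (fun x : E => ‖x‖⁻¹ • x) x) x :=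
      ((contDiffOn_normalize.differentiableOn one_ne_zero).differentiableAt
        (hopen.mem_nhds hx)).hasFDerivAt
    exact (hasFDerivAt_of_quadratic_remainder (h _ (norm_normalize hx))).comp
      (f := fun x : E => ‖x‖⁻¹ • x) x h1
  have hV : ContinuousOn V (Metric.sphere 0 1) := by
    intro x hx
    have hx : ‖x‖ = 1 := by simpa using hx
    refine tendsto_iff_norm_sub_tendsto_zero.2 ?_
    have hlim : Filter.Tendsto (fun y => 6 * C * ‖y - x‖)
        (nhdsWithin x (Metric.sphere 0 1)) (nhds 0) := by
      have : Continuous fun y => 6 * C * ‖y - x‖ := by fun_prop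
      simpa using (this.tendsto x).mono_left nhdsWithin_le_nhds
    refine squeeze_zero' (Filter.Eventually.of_forall fun _ => norm_nonneg _) ?_ hlim
    filter_upwards [self_mem_nhdsWithin, nhdsWithin_le_nhds
      (Metric.closedBall_mem_nhds x (show (0 : ℝ) < 1 / 2 by norm_num))] with y hy hyx
    exact norm_sub_le_of_quadratic_remainder h (by simpa using hy) hx
      (by simpa [dist_eq_norm] using hyx) hC
  refine ⟨?_, fun x hx => (hder x hx).fderiv⟩
  rw [show (1 : WithTop ℕ∞) = 0 + 1 by simp, contDiffOn_succ_iff_fderiv_of_isOpen hopen]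
  refine ⟨fun x hx => (hder x hx).differentiableAt.differentiableWithinAt, by simp,
    contDiffOn_zero.2 ?_⟩
  have hcomp : ContinuousOn (fun x : E =>
      (V (‖x‖⁻¹ • x)).comp (fderiv ℝ (fun x : E => ‖x‖⁻¹ • x) x)) {0}ᶜ := by
    refine ContinuousOn.clm_comp (hV.comp contDiffOn_normalize.continuousOn fun x hx => ?_)
      (contDiffOn_normalize.continuousOn_fderiv_of_isOpen hopen le_rfl)
    simpa using norm_normalize hx
  exact hcomp.congr fun x hx => (hder x hx).fderiv

end Radial

/-! ### Regularity of potentials -/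

section Regularity

variable {n : ℕ} {α : ℝ}

theorem continuous_norm_one_sub_hermProd_right (ξ : CRSphere n) :
    Continuous fun η : CRSphere n => ‖1 - hermProd ξ η‖ :=
  (continuous_const.sub (continuous_hermProd.comp (continuous_const.prodMk continuous_id))).norm

theorem exists_integral_norm_rpow_le {r : ℝ} (hr : -((n : ℝ) + 1) < r) :
    ∃ B : ℝ, 0 < B ∧ ∀ ξ : CRSphere n,
      Integrable (fun η => ‖1 - hermProd ξ η‖ ^ r) (surfaceMeasure n) ∧
        ∫ η, ‖1 - hermProd ξ η‖ ^ r ∂(surfaceMeasure n) ≤ B := by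
  rcases lt_or_ge r 0 with h0 | h0
  · obtain ⟨B, hB0, hB⟩ := exists_lintegral_rpow_neg_le n (β := -r) (by linarith) (by linarith)
    refine ⟨B, hB0, fun ξ => ?_⟩
    have h := hB ξ
    rw [neg_neg] at h
    have hnn : 0 ≤ᵐ[surfaceMeasure n] fun η => ‖1 - hermProd ξ η‖ ^ r :=
      Filter.Eventually.of_forall fun η => Real.rpow_nonneg (norm_nonneg _) r
    have hi : Integrable (fun η => ‖1 - hermProd ξ η‖ ^ r) (surfaceMeasure n) := by
      refine ⟨((continuous_norm_one_sub_hermProd_right ξ).measurable.pow_const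
        r).aestronglyMeasurable, ?_⟩
      rw [hasFiniteIntegral_iff_ofReal hnn]
      exact h.trans_lt ENNReal.ofReal_lt_top
    refine ⟨hi, ?_⟩
    rwa [← ofReal_integral_eq_lintegral_ofReal hi hnn, ENNReal.ofReal_le_ofReal_iff hB0.le] at h
  · have hi : ∀ ξ : CRSphere n,
        Integrable (fun η => ‖1 - hermProd ξ η‖ ^ r) (surfaceMeasure n) := fun ξ =>
      ((continuous_norm_one_sub_hermProd_right ξ).rpow_const
        fun _ => Or.inr h0).integrable_of_compactSpace
    refine ⟨2 ^ r * (surfaceMeasure n).real Set.univ + 1, by positivity, fun ξ => ⟨hi ξ, ?_⟩⟩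
    have := integral_mono (hi ξ) (integrable_const (2 ^ r)) fun η =>
      Real.rpow_le_rpow (norm_nonneg _) (norm_one_sub_hermProd_le_two ξ η) h0
    rw [integral_const, smul_eq_mul, mul_comm] at this
    linarith

/-- The extension of `hlsPotential α g` to `ℂ^{n+1}` given by the same integral. -/
def ambientPotential (α : ℝ) (g : CRSphere n → ℝ) (x : CSpace n) : ℝ :=
  ∫ η, ‖1 - inner ℂ (η : CSpace n) x‖ ^ ((α - homDim n) / 2) * g η ∂(surfaceMeasure n)

/-- The gradient of `ambientPotential α g`, obtained by differentiating under the integral. -/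
def ambientPotentialGradient (α : ℝ) (g : CRSphere n → ℝ) (x : CSpace n) : CSpace n :=
  ∫ η, (-((α - homDim n) / 2 * ‖1 - inner ℂ (η : CSpace n) x‖ ^ ((α - homDim n) / 2 - 2) * g η)) •
    ((1 - inner ℂ (η : CSpace n) x) • (η : CSpace n)) ∂(surfaceMeasure n)

theorem CSpace.real_inner_smul_left (c : ℂ) (x y : CSpace n) :
    inner ℝ (c • x) y = (conj c * inner ℂ x y).re := by
  rw [← inner_smul_left]
  simp [PiLp.inner_apply, Complex.inner]

/-- At the points of the sphere the potential of a bounded function has a first order expansion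
with quadratic remainder. The remainder for the kernel is at most
`C |y|² (|1 - ξ · η̄| ^ (λ - 2) + 1)` with `λ = (α - Q) / 2 > 0`; this is integrable because
`2 - λ < 2 ≤ n + 1`. -/
theorem exists_ambientPotential_quadratic_remainder (hn : 1 ≤ n) (hα : homDim n < α) :
    ∃ C R : ℝ, 0 ≤ C ∧ 0 ≤ R ∧ ∀ (g : CRSphere n → ℝ) (M : ℝ), Continuous g →
      (∀ ξ, |g ξ| ≤ M) → ∀ x : CSpace n, ‖x‖ = 1 →
        (∀ y : CSpace n, ‖y‖ ≤ 1 → |ambientPotential α g (x + y) - ambientPotential α g x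
          - innerSL ℝ (ambientPotentialGradient α g x) y| ≤ C * M * ‖y‖ ^ 2) ∧
        ‖innerSL ℝ (ambientPotentialGradient α g x)‖ ≤ R * M := by
  set lam := (α - homDim n) / 2 with hlam
  have hlam0 : 0 < lam := by rw [hlam]; linarith
  obtain ⟨C, hC0, hC⟩ := Complex.exists_abs_norm_rpow_sub_taylor_le hlam0
  have hn' : (1 : ℝ) ≤ n := by exact_mod_cast hn
  obtain ⟨B, hB0, hB⟩ := exists_integral_norm_rpow_le (n := n) (r := lam - 2) (by linarith)
  set m := (surfaceMeasure n).real Set.univ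
  have hm0 : 0 ≤ m := measureReal_nonneg
  refine ⟨C * (B + m), lam * 2 * B, by positivity, by positivity, ?_⟩
  intro g M hg hgM x hx
  let ξ : CRSphere n := ⟨x, by simpa using hx⟩
  have hM0 : 0 ≤ M := (abs_nonneg _).trans (hgM ξ)
  obtain ⟨hBi, hBle⟩ := hB ξ
  have hwξ : ∀ η : CRSphere n, 1 - inner ℂ (η : CSpace n) x = 1 - hermProd ξ η := fun η => by
    rw [hermProd_eq_inner]
  set σ := surfaceMeasure n
  have hinner : ∀ z : CSpace n, Continuous fun η : CRSphere n => 1 - inner ℂ (η : CSpace n) z :=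
    fun z => by fun_prop
  -- integrability of the integrand of the gradient
  set Γ : CRSphere n → CSpace n := fun η => (-(lam * ‖1 - inner ℂ (η : CSpace n) x‖ ^ (lam - 2) *
    g η)) • ((1 - inner ℂ (η : CSpace n) x) • (η : CSpace n)) with hΓ
  have hΓle : ∀ η, ‖Γ η‖ ≤ lam * 2 * M * ‖1 - hermProd ξ η‖ ^ (lam - 2) := fun η => by
    have h1 : ‖1 - hermProd ξ η‖ ≤ 2 := norm_one_sub_hermProd_le_two ξ η
    rw [hΓ]
    simp only [hwξ]
    rw [norm_smul, norm_smul, CRSphere.norm_coe, mul_one, norm_neg, norm_mul, norm_mul,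
      Real.norm_of_nonneg hlam0.le, Real.norm_of_nonneg (Real.rpow_nonneg (norm_nonneg _) _),
      Real.norm_eq_abs]
    have h0 : 0 ≤ ‖1 - hermProd ξ η‖ ^ (lam - 2) := Real.rpow_nonneg (norm_nonneg _) _
    calc lam * ‖1 - hermProd ξ η‖ ^ (lam - 2) * |g η| * ‖1 - hermProd ξ η‖
        ≤ lam * ‖1 - hermProd ξ η‖ ^ (lam - 2) * M * 2 := by gcongr; exact hgM η
      _ = _ := by ring
  have hΓm : AEStronglyMeasurable Γ σ := by
    have hw : Continuous fun η : CRSphere n => (1 - inner ℂ (η : CSpace n) x) • (η : CSpace n) :=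
      (hinner x).smul continuous_subtype_val
    have hr : AEStronglyMeasurable (fun η : CRSphere n =>
        -(lam * ‖1 - inner ℂ (η : CSpace n) x‖ ^ (lam - 2) * g η)) σ :=
      (((((hinner x).norm.measurable.pow_const _).const_mul _).mul
        hg.measurable).neg).aestronglyMeasurable
    exact hr.smul hw.aestronglyMeasurable
  have hΓi : Integrable Γ σ := (hBi.const_mul (lam * 2 * M)).mono' hΓm
    (Filter.Eventually.of_forall hΓle)
  have hGeq : ambientPotentialGradient α g x = ∫ η, Γ η ∂σ := rfl
  have hUi : ∀ z : CSpace n, Integrable (fun η : CRSphere n =>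
      ‖1 - inner ℂ (η : CSpace n) z‖ ^ lam * g η) σ := fun z =>
    (((hinner z).norm.rpow_const fun _ => Or.inr hlam0.le).mul hg).integrable_of_compactSpace
  refine ⟨fun y hy => ?_, ?_⟩
  · have hGy : innerSL ℝ (ambientPotentialGradient α g x) y = ∫ η, inner ℝ (Γ η) y ∂σ := by
      rw [innerSL_apply_apply, hGeq, real_inner_comm, ← integral_inner hΓi]
      simp_rw [real_inner_comm]
    have hΓyi : Integrable (fun η => inner ℝ (Γ η) y) σ := hΓi.inner_const y
    have hdi : Integrable (fun η : CRSphere n => ‖1 - inner ℂ (η : CSpace n) (x + y)‖ ^ lam * g η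
        - ‖1 - inner ℂ (η : CSpace n) x‖ ^ lam * g η) σ := (hUi _).sub (hUi _)
    rw [hGy, ambientPotential, ambientPotential, ← integral_sub (hUi _) (hUi _),
      ← integral_sub hdi hΓyi, ← Real.norm_eq_abs]
    have hae : ∀ᵐ (η : CRSphere n) ∂σ, ‖‖1 - inner ℂ (η : CSpace n) (x + y)‖ ^ lam * g η
        - ‖1 - inner ℂ (η : CSpace n) x‖ ^ lam * g η - inner ℝ (Γ η) y‖
        ≤ C * M * ‖y‖ ^ 2 * (‖1 - hermProd ξ η‖ ^ (lam - 2) + 1) := by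
      have hne : ∀ᵐ η ∂σ, η ∉ ({ξ} : Set (CRSphere n)) :=
        measure_eq_zero_iff_ae_notMem.1 (measure_singleton _)
      filter_upwards [hne] with η hη
      have hη : ξ ≠ η := fun h => hη h.symm
      set w : ℂ := 1 - inner ℂ (η : CSpace n) x with hw
      set v : ℂ := -inner ℂ (η : CSpace n) y with hv
      have hw0 : w ≠ 0 := by
        rw [hw, hwξ]; exact fun h => hη (one_sub_hermProd_eq_zero_iff.1 h)
      have hvy : ‖v‖ ≤ ‖y‖ := by
        rw [hv, norm_neg]
        refine (norm_inner_le_norm _ _).trans ?_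
        rw [CRSphere.norm_coe, one_mul]
      have h1 := hC w v hw0 (hvy.trans hy)
      have h2 : 1 - inner ℂ (η : CSpace n) (x + y) = w + v := by rw [inner_add_right]; ring
      have h3 : inner ℝ (Γ η) y = lam * ‖w‖ ^ (lam - 2) * (conj w * v).re * g η := by
        simp only [hΓ]
        rw [real_inner_smul_left, CSpace.real_inner_smul_left, hv, mul_neg, Complex.neg_re]
        ring
      rw [h2, h3, ← sub_mul, ← sub_mul, norm_mul, Real.norm_eq_abs, Real.norm_eq_abs, ← hwξ, ← hw]
      have h4 : 0 ≤ ‖w‖ ^ (lam - 2) + 1 := by positivity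
      calc _ ≤ C * ‖v‖ ^ 2 * (‖w‖ ^ (lam - 2) + 1) * M :=
            mul_le_mul h1 (hgM η) (abs_nonneg _) (by positivity)
        _ ≤ C * ‖y‖ ^ 2 * (‖w‖ ^ (lam - 2) + 1) * M := by gcongr
        _ = _ := by ring
    refine (norm_integral_le_of_norm_le ((hBi.add (integrable_const 1)).const_mul _) hae).trans ?_
    simp only [Pi.add_apply]
    rw [integral_const_mul, integral_add hBi (integrable_const 1), integral_const, smul_eq_mul,
      mul_one]
    calc C * M * ‖y‖ ^ 2 * (∫ η, ‖1 - hermProd ξ η‖ ^ (lam - 2) ∂σ + m)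
        ≤ C * M * ‖y‖ ^ 2 * (B + m) := by gcongr
      _ = _ := by ring
  · rw [innerSL_apply_norm, hGeq]
    refine (norm_integral_le_of_norm_le (hBi.const_mul (lam * 2 * M))
      (Filter.Eventually.of_forall hΓle)).trans ?_
    rw [integral_const_mul]
    calc lam * 2 * M * ∫ η, ‖1 - hermProd ξ η‖ ^ (lam - 2) ∂σ ≤ lam * 2 * M * B := by gcongr
      _ = _ := by ring

theorem radialExt_of_ne_zero (f : CRSphere n → ℝ) {x : CSpace n} (hx : x ≠ 0) :
    radialExt f x = f ⟨(‖x‖⁻¹ : ℝ) • x, by simpa using norm_normalize hx⟩ := by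
  rw [radialExt, dif_neg hx]

theorem radialExt_coe (f : CRSphere n → ℝ) (ξ : CRSphere n) : radialExt f ξ = f ξ := by
  rw [radialExt_of_ne_zero f (ne_zero_of_mem_unit_sphere ξ)]
  congr 1
  apply Subtype.ext
  simp

theorem radialExt_hlsPotential (g : CRSphere n → ℝ) {x : CSpace n} (hx : x ≠ 0) :
    radialExt (hlsPotential α g) x = ambientPotential α g ((‖x‖⁻¹ : ℝ) • x) := by
  rw [radialExt_of_ne_zero _ hx, hlsPotential, ambientPotential]
  refine integral_congr_ae (Filter.Eventually.of_forall fun η => ?_)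
  simp only [hlsKernel, hermProd_eq_inner]

/-- The potential of a continuous function is `C^1`, with a gradient controlled by the supremum
of the function. -/
theorem exists_radialExt_hlsPotential_bound (hn : 1 ≤ n) (hα : homDim n < α) :
    ∃ R : ℝ, 0 ≤ R ∧ ∀ (g : CRSphere n → ℝ) (M : ℝ), Continuous g → (∀ ξ, |g ξ| ≤ M) →
      ContDiffOn ℝ 1 (radialExt (hlsPotential α g)) {0}ᶜ ∧
        ∀ ξ : CRSphere n, ‖fderiv ℝ (radialExt (hlsPotential α g)) (ξ : CSpace n)‖ ≤ R * M := by
  obtain ⟨C, R, hC0, hR0, H⟩ := exists_ambientPotential_quadratic_remainder hn hα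
  -- the derivative of `x ↦ x / ‖x‖` is bounded on the sphere
  have hcont : ContinuousOn (fderiv ℝ fun x : CSpace n => (‖x‖⁻¹ : ℝ) • x) (Metric.sphere 0 1) :=
    (contDiffOn_normalize.continuousOn_fderiv_of_isOpen isOpen_compl_singleton le_rfl).mono
      fun x hx => ne_zero_of_mem_unit_sphere ⟨x, hx⟩
  obtain ⟨D, hD⟩ := (isCompact_sphere (0 : CSpace n) 1).exists_bound_of_continuousOn hcont
  obtain ⟨x₀, hx₀⟩ : (Metric.sphere (0 : CSpace n) 1).Nonempty :=
    NormedSpace.sphere_nonempty.2 zero_le_one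
  have hD0 : 0 ≤ D := (norm_nonneg _).trans (hD x₀ hx₀)
  refine ⟨R * D, by positivity, fun g M hg hgM => ?_⟩
  have hM0 : 0 ≤ M := (abs_nonneg _).trans (hgM ⟨x₀, hx₀⟩)
  obtain ⟨h1, h2⟩ := contDiffOn_comp_normalize_of_quadratic_remainder
    (U := ambientPotential α g) (V := fun x => innerSL ℝ (ambientPotentialGradient α g x))
    (C := C * M) (by positivity) fun x hx => (H g M hg hgM x hx).1
  refine ⟨h1.congr fun x hx => radialExt_hlsPotential g hx, fun ξ => ?_⟩
  have hξ : (ξ : CSpace n) ≠ 0 := ne_zero_of_mem_unit_sphere ξ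
  have hev : radialExt (hlsPotential α g) =ᶠ[nhds (ξ : CSpace n)]
      fun x => ambientPotential α g ((‖x‖⁻¹ : ℝ) • x) := by
    filter_upwards [isOpen_compl_singleton.mem_nhds hξ] with x hx
    exact radialExt_hlsPotential g hx
  rw [hev.fderiv_eq, h2 _ hξ]
  refine (ContinuousLinearMap.opNorm_comp_le _ _).trans ?_
  have hV := (H g M hg hgM _ (norm_normalize hξ)).2
  calc _ ≤ (R * M) * D := mul_le_mul hV (hD _ ξ.2) (norm_nonneg _) (by positivity)
    _ = _ := by ring

theorem isC1_of_contDiffOn_radialExt {f : CRSphere n → ℝ}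
    (hf : ContDiffOn ℝ 1 (radialExt f) {0}ᶜ) : IsC1 f := by
  have h1 : ContMDiffOn 𝓘(ℝ, CSpace n) 𝓘(ℝ, ℝ) 1 (radialExt f) {0}ᶜ := hf.contMDiffOn
  have h2 : ContMDiff (𝓡 (2 * n + 1)) 𝓘(ℝ, CSpace n) 1 ((↑) : CRSphere n → CSpace n) :=
    contMDiff_coe_sphere
  have h3 := h1.comp_contMDiff h2 fun ξ => ne_zero_of_mem_unit_sphere ξ
  have h4 : radialExt f ∘ ((↑) : CRSphere n → CSpace n) = f := funext fun ξ => radialExt_coe f ξ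
  rwa [h4] at h3

theorem exists_isC1_rpow_hlsPotential (hn : 1 ≤ n) (hα : homDim n < α) {c k e : ℝ} (hc : 0 < c)
    (hk : 0 < k) (he : e ≤ 1) (M : ℝ) :
    ∃ R : ℝ, ∀ f g : CRSphere n → ℝ, Continuous g → (∀ ξ, |g ξ| ≤ M) →
      (∀ ξ, c ≤ hlsPotential α g ξ) → (∀ ξ, f ξ = (k * hlsPotential α g ξ) ^ e) →
      IsC1 f ∧ ∀ ξ : CRSphere n, ‖fderiv ℝ (radialExt f) (ξ : CSpace n)‖ ≤ R := by
  obtain ⟨R, hR0, hR⟩ := exists_radialExt_hlsPotential_bound hn hα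
  refine ⟨|e| * (k * c) ^ (e - 1) * (k * (R * M)), fun f g hg hgM hgc hf => ?_⟩
  obtain ⟨hCD, hbd⟩ := hR g M hg hgM
  have hext : ∀ x : CSpace n, x ≠ 0 →
      radialExt f x = (k * radialExt (hlsPotential α g) x) ^ e := fun x hx => by
    rw [radialExt_of_ne_zero _ hx, radialExt_of_ne_zero _ hx, hf]
  have hpos : ∀ x : CSpace n, x ≠ 0 → k * radialExt (hlsPotential α g) x ≠ 0 := fun x hx => by
    rw [radialExt_of_ne_zero _ hx]
    exact (mul_pos hk (hc.trans_le (hgc _))).ne'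
  refine ⟨isC1_of_contDiffOn_radialExt (((contDiffOn_const.mul hCD).rpow_const_of_ne
    fun x hx => hpos x hx).congr fun x hx => hext x hx), fun ξ => ?_⟩
  have hξ : (ξ : CSpace n) ≠ 0 := ne_zero_of_mem_unit_sphere ξ
  have hev : radialExt f =ᶠ[nhds (ξ : CSpace n)]
      fun x => (k * radialExt (hlsPotential α g) x) ^ e := by
    filter_upwards [isOpen_compl_singleton.mem_nhds hξ] with x hx
    exact hext x hx
  have hd := ((hCD.differentiableOn one_ne_zero).differentiableAt
    (isOpen_compl_singleton.mem_nhds hξ)).hasFDerivAt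
  rw [hev.fderiv_eq, ((hd.const_mul k).rpow_const (p := e) (Or.inl (hpos _ hξ))).fderiv,
    norm_smul, norm_smul, norm_mul, Real.norm_eq_abs, Real.norm_of_nonneg hk.le, radialExt_coe]
  have h1 : k * c ≤ k * hlsPotential α g ξ := mul_le_mul_of_nonneg_left (hgc ξ) hk.le
  have hkc : 0 < k * c := mul_pos hk hc
  rw [Real.norm_of_nonneg (Real.rpow_nonneg (hkc.le.trans h1) _)]
  have h2 := Real.rpow_le_rpow_of_nonpos hkc h1 (show e - 1 ≤ 0 by linarith)
  have h3 := hbd ξ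
  gcongr

end Regularity

/-! ### Minimizers -/

section Minimizers

variable {n : ℕ} {α p : ℝ}

/-- Continuous minimizers satisfy the Euler–Lagrange equations, which together with the a priori
bounds make them `C^1` and bounded above and below, uniformly. -/
theorem exists_bounds_of_continuous_minimizer (hn : 1 ≤ n) (hα : homDim n < α) (hp0 : 0 < p)
    (hp : p < critExp n α) :
    ∃ a b R : ℝ, 0 < a ∧ 0 < b ∧ 0 ≤ R ∧ ∀ f g : CRSphere n → ℝ, Continuous f → Continuous g →
      IsNormalized p f → IsNormalized p g → hlsConst n α p = hlsEnergy α f g →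
      IsC1 f ∧ (∀ ξ, (hlsConst n α p).toReal * f ξ ^ (p - 1) = hlsPotential α g ξ) ∧
        (∀ ξ, a ≤ f ξ ∧ f ξ ≤ b) ∧
        ∀ ξ : CRSphere n, ‖fderiv ℝ (radialExt f) (ξ : CSpace n)‖ ≤ R := by
  have hp1 := hp.trans (critExp_lt_one hα)
  obtain ⟨M, c, hM, hc, hb⟩ := exists_bounds_of_hlsEnergy_le_hlsConst_add_one hα hp0 hp
  set N := (hlsConst n α p).toReal with hNdef
  have hEL : ∀ f g : CRSphere n → ℝ, Continuous f → Continuous g →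
      IsNormalized p f → IsNormalized p g → hlsConst n α p = hlsEnergy α f g →
      ∀ ξ, 0 < f ξ ∧ N * f ξ ^ (p - 1) = hlsPotential α g ξ ∧ c ≤ hlsPotential α g ξ ∧
        hlsPotential α g ξ ≤ 2 ^ ((α - homDim n) / 2) * M := by
    intro f g hfc hgc hf hg hmin ξ
    obtain ⟨-, hgi, hgM, hgl⟩ := hb f g hf hg (hmin ▸ le_self_add)
    obtain ⟨h1, h2⟩ := eulerLagrange_of_continuous hα hp0 hp1 hf hfc hg hgc
      (fun ξ => hc.trans_le (hgl ξ)) hmin ξ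
    exact ⟨h1, h2, hgl ξ, (hlsPotential_le hα hg.1 hgi ξ).trans
      (mul_le_mul_of_nonneg_left hgM (by positivity))⟩
  have hN : 0 < N := by
    obtain ⟨f, g, hfc, hgc, hf, hg, hmin⟩ := exists_continuous_minimizer hα hp0 hp
    obtain ⟨ξ⟩ : Nonempty (CRSphere n) :=
      (NormedSpace.sphere_nonempty.2 zero_le_one).to_subtype
    obtain ⟨h1, h2, h3, -⟩ := hEL f g hfc hgc hf hg hmin ξ
    refine pos_of_mul_pos_left (b := f ξ ^ (p - 1)) ?_ (Real.rpow_nonneg h1.le _)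
    rw [h2]
    exact hc.trans_le h3
  have he : 1 / (p - 1) < 0 := one_div_neg.2 (by linarith)
  set D := 2 ^ ((α - homDim n) / 2) * M
  have hD : 0 < D := by positivity
  have hform : ∀ f g : CRSphere n → ℝ, Continuous f → Continuous g →
      IsNormalized p f → IsNormalized p g → hlsConst n α p = hlsEnergy α f g →
      ∀ ξ, f ξ = (N⁻¹ * hlsPotential α g ξ) ^ (1 / (p - 1)) ∧
        (N⁻¹ * D) ^ (1 / (p - 1)) ≤ f ξ ∧ f ξ ≤ (N⁻¹ * c) ^ (1 / (p - 1)) := by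
    intro f g hfc hgc hf hg hmin ξ
    obtain ⟨h1, h2, h3, h4⟩ := hEL f g hfc hgc hf hg hmin ξ
    have h5 : f ξ = (N⁻¹ * hlsPotential α g ξ) ^ (1 / (p - 1)) := by
      rw [← h2, inv_mul_cancel_left₀ hN.ne', ← Real.rpow_mul h1.le,
        mul_one_div_cancel (by linarith), Real.rpow_one]
    have hg0 : 0 < hlsPotential α g ξ := hc.trans_le h3
    refine ⟨h5, ?_, ?_⟩
    · rw [h5]
      exact Real.rpow_le_rpow_of_nonpos (by positivity) (by gcongr) he.le
    · rw [h5]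
      exact Real.rpow_le_rpow_of_nonpos (by positivity) (by gcongr) he.le
  obtain ⟨R, hR⟩ := exists_isC1_rpow_hlsPotential hn hα hc (inv_pos.2 hN)
    (he.le.trans zero_le_one) ((N⁻¹ * c) ^ (1 / (p - 1)))
  refine ⟨(N⁻¹ * D) ^ (1 / (p - 1)), (N⁻¹ * c) ^ (1 / (p - 1)), max R 0, by positivity,
    by positivity, le_max_right _ _, ?_⟩
  intro f g hfc hgc hf hg hmin
  have hmin' : hlsConst n α p = hlsEnergy α g f := by
    rwa [hlsEnergy_comm hα hg.aemeasurable hf.aemeasurable]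
  have hfg := hform f g hfc hgc hf hg hmin
  have hgf := hform g f hgc hfc hg hf hmin'
  obtain ⟨hC1, hder⟩ := hR f g hgc (fun ξ => by
    rw [abs_of_nonneg (hg.1 ξ)]; exact (hgf ξ).2.2)
    (fun ξ => (hEL f g hfc hgc hf hg hmin ξ).2.2.1) fun ξ => (hfg ξ).1
  exact ⟨hC1, fun ξ => (hEL f g hfc hgc hf hg hmin ξ).2.1, fun ξ => (hfg ξ).2,
    fun ξ => (hder ξ).trans (le_max_left _ _)⟩

theorem c1Norm_le {f : CRSphere n → ℝ} {b R : ℝ} (hb : 0 ≤ b) (hR : 0 ≤ R)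
    (hf : ∀ ξ, |f ξ| ≤ b)
    (hf' : ∀ ξ : CRSphere n, ‖fderiv ℝ (radialExt f) (ξ : CSpace n)‖ ≤ R) :
    c1Norm f ≤ ENNReal.ofReal (b + R) := by
  rw [ENNReal.ofReal_add hb hR, c1Norm]
  refine add_le_add (iSup_le fun ξ => ?_) (iSup_le fun ξ => ?_)
  · rw [← ofReal_norm]
    exact ENNReal.ofReal_le_ofReal (hf ξ)
  · rw [← ofReal_norm]
    exact ENNReal.ofReal_le_ofReal (hf' ξ)

end Minimizers

end

theorem mainTheorem4 (n : ℕ) (hn : 1 ≤ n) (α p : ℝ) (hα : homDim n < α)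
    (hp0 : 0 < p) (hp : p < critExp n α) :
    (∃ f g : CRSphere n → ℝ, IsC1MinimizerPair α p f g) ∧
    (∀ f g : CRSphere n → ℝ, IsC1MinimizerPair α p f g →
      ∀ ξ : CRSphere n,
        (hlsConst n α p).toReal * f ξ ^ (p - 1)
            = ∫ η, hlsKernel α ξ η * g η ∂(surfaceMeasure n) ∧
        (hlsConst n α p).toReal * g ξ ^ (p - 1)
            = ∫ η, hlsKernel α ξ η * f η ∂(surfaceMeasure n)) ∧
    (∃ C : ℝ, 0 < C ∧ ∀ f g : CRSphere n → ℝ, IsC1MinimizerPair α p f g →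
      (∀ ξ : CRSphere n, 1 / C < f ξ ∧ f ξ < C ∧ 1 / C < g ξ ∧ g ξ < C) ∧
      c1Norm f ≤ ENNReal.ofReal C ∧ c1Norm g ≤ ENNReal.ofReal C) := by
  obtain ⟨a, b, R, ha, hb, hR, H⟩ := exists_bounds_of_continuous_minimizer hn hα hp0 hp
  have hcomm : ∀ f g : CRSphere n → ℝ, IsNormalized p f → IsNormalized p g →
      hlsConst n α p = hlsEnergy α f g → hlsConst n α p = hlsEnergy α g f :=
    fun f g hf hg h => by rwa [hlsEnergy_comm hα hg.aemeasurable hf.aemeasurable]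
  have H₁ : ∀ f g : CRSphere n → ℝ, IsC1MinimizerPair α p f g → _ := fun f g h =>
    H f g h.left_c1.continuous h.right_c1.continuous h.left_normalized h.right_normalized h.attains
  have H₂ : ∀ f g : CRSphere n → ℝ, IsC1MinimizerPair α p f g → _ := fun f g h =>
    H g f h.right_c1.continuous h.left_c1.continuous h.right_normalized h.left_normalized
      (hcomm f g h.left_normalized h.right_normalized h.attains)
  refine ⟨?_, fun f g h ξ => ⟨(H₁ f g h).2.1 ξ, (H₂ f g h).2.1 ξ⟩, ?_⟩
  · obtain ⟨f, g, hfc, hgc, hf, hg, hmin⟩ := exists_continuous_minimizer hα hp0 hp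
    exact ⟨f, g, (H f g hfc hgc hf hg hmin).1,
      (H g f hgc hfc hg hf (hcomm f g hf hg hmin)).1, hf, hg, hmin⟩
  · have hainv : 0 < a⁻¹ := inv_pos.2 ha
    set C := a⁻¹ + b + R + 1 with hC
    have hC0 : 0 < C := by positivity
    have hCa : 1 / C < a := by
      rw [one_div, inv_lt_comm₀ hC0 ha]
      linarith
    have hle : ENNReal.ofReal (b + R) ≤ ENNReal.ofReal C :=
      ENNReal.ofReal_le_ofReal (by linarith)
    have habs : ∀ f : CRSphere n → ℝ, (∀ ξ, a ≤ f ξ ∧ f ξ ≤ b) → ∀ ξ, |f ξ| ≤ b :=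
      fun f hf ξ => abs_le.2 ⟨by linarith [(hf ξ).1], (hf ξ).2⟩
    refine ⟨C, hC0, fun f g h => ?_⟩
    obtain ⟨-, -, hf, hf'⟩ := H₁ f g h
    obtain ⟨-, -, hg, hg'⟩ := H₂ f g h
    refine ⟨fun ξ => ⟨hCa.trans_le (hf ξ).1, (hf ξ).2.trans_lt (by linarith),
      hCa.trans_le (hg ξ).1, (hg ξ).2.trans_lt (by linarith)⟩,
      (c1Norm_le hb.le hR (habs f hf) hf').trans hle,
      (c1Norm_le hb.le hR (habs g hg) hg').trans hle⟩
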